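/- Let $\mathrm{Dyck}(s)$ be the language of well-balanced strings over $s$ types of parentheses, generated by $S\to\varepsilon$, $S\to SS$, $S\to aS\bar a$, where $a$ is any open parenthesis and $\bar a$ is its congruent close parenthesis. For a string $\sigma$ of length $n$ over these $2s$ symbols let $d$ be its edit distance to $\mathrm{Dyck}(s)$, the least number of insertions, deletions and substitutions of single symbols that turn $\sigma$ into a string of $\mathrm{Dyck}(s)$. Remove all well-formed substrings of $\sigma$, then the leading close and the trailing open parentheses; write what remains as $Y_1X_1Y_2X_2\cdots Y_zX_z$ with nonempty runs $Y_i$ of open and $X_i$ of close parentheses. This defines the number $z\ge 0$ of blocks. Suppose there is an algorithm StrEdit which, on two strings of total length $m$, takes $\alpha(m)$ time and returns a number that is at least their string edit distance and at most $\beta(m)$ times it, where $\alpha(a)+\alpha(b)\le\alpha(a+b)$ for all $a,b$ and $\beta$ is nondecreasing. Then there is a randomized algorithm with StrEdit as a subroutine which, for every $s\ge 2$ and every string $\sigma$ over $s$ types of parentheses, runs in $O(n\log n+\alpha(n)+1)$ time, returns a number that is always at least $d$ (and equal to $0$ if $d=0$), and, if $d\ge1$, returns with probability at least $1-\frac1n-\frac1d$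 a number that is at most $O\big(\beta(n)\,(1+\log z)\,\sqrt{\log d}\,\big)\cdot d$ (with $\log 0$ read as $0$). The program and the constants hidden in the $O$-notation are universal: they depend on none of $s$, $\sigma$, $\alpha$, $\beta$ and StrEdit. Time is counted on a random access machine with unit-cost instructions (constants, copying, adding or subtracting one, comparison, array access, fair coin tosses), on which a subroutine call on strings of total length $m$ takes $\alpha(m)+1$ steps. -/

import Mathlib

open MeasureTheory

namespace DyckEdit

/-! ### Strings of parentheses, the Dyck language, edit distance -/

/-- Parentheses of `s` types: an open one and its congruent close one for each type. -/
inductive Paren (s : ℕ) : Type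
  | opn : Fin s → Paren s
  | cls : Fin s → Paren s
  deriving DecidableEq

/-- The type of a parenthesis, as a number. -/
def Paren.type {s : ℕ} : Paren s → ℕ
  | .opn a => a
  | .cls a => a

/-- `0` for an open parenthesis, `1` for a close one. -/
def Paren.kind {s : ℕ} : Paren s → ℕ
  | .opn _ => 0
  | .cls _ => 1

/-- The well-balanced strings over `s` types of parentheses: the language of the grammar
`S → ε`, `S → S S`, `S → a S ā`. -/
inductive IsDyck {s : ℕ} : List (Paren s) → Prop
  | nil : IsDyck []
  | append {u v : List (Paren s)} : IsDyck u → IsDyck v → IsDyck (u ++ v)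
  | wrap (a : Fin s) {u : List (Paren s)} : IsDyck u → IsDyck (.opn a :: (u ++ [.cls a]))

/-- `Edits u v k`: some left-to-right alignment turns the string `u` into the string `v` with
exactly `k` insertions, deletions and substitutions of single symbols. -/
inductive Edits {A : Type*} : List A → List A → ℕ → Prop
  | nil : Edits [] [] 0
  | keep (a : A) {u v : List A} {k : ℕ} : Edits u v k → Edits (a :: u) (a :: v) k
  | subst (a b : A) {u v : List A} {k : ℕ} : Edits u v k → Edits (a :: u) (b :: v) (k + 1)
  | delete (a : A) {u v : List A} {k : ℕ} : Edits u v k → Edits (a :: u) v (k + 1)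
  | insert (b : A) {u v : List A} {k : ℕ} : Edits u v k → Edits u (b :: v) (k + 1)

/-- String edit distance: the least number of insertions, deletions and substitutions. -/
noncomputable def strEdit {A : Type*} (u v : List A) : ℕ :=
  sInf {k | Edits u v k}

/-- Edit distance of a string of parentheses to the Dyck language. -/
noncomputable def dyckDist {s : ℕ} (σ : List (Paren s)) : ℕ :=
  sInf {k | ∃ w, IsDyck w ∧ Edits σ w k}

/-! ### The number of blocks -/

/-- One step of the greedy removal of well-formed substrings. The head of `st` is the last symbol
that has been kept so far; a close parenthesis cancels against its congruent. -/
def cancelStep {s : ℕ} (st : List (Paren s)) (x : Paren s) : List (Paren s) :=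
  match x, st with
  | .cls b, .opn a :: rest => if a = b then rest else x :: st
  | _, _ => x :: st

/-- What is left of `σ` after all well-formed substrings have been removed. -/
def cancel {s : ℕ} (σ : List (Paren s)) : List (Paren s) :=
  (σ.foldl cancelStep []).reverse

/-- The number of blocks of a string: after removal of the leading close and the trailing open
parentheses it is `Y₁X₁⋯Y_zX_z` with nonempty runs `Yᵢ` of open and `Xᵢ` of close parentheses, and
`z` is the number of places where an open parenthesis is directly followed by a close one. -/
def numBlocks {s : ℕ} (w : List (Paren s)) : ℕ :=
  (w.zip w.tail).countP fun p => p.1.kind == 0 && p.2.kind == 1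

/-! ### Randomized random access machines with a string edit distance subroutine

The machine has registers and arrays (finitely many of either occur in a program) that hold natural
numbers. The only arithmetic is adding or subtracting one, so that no number can grow by more than
one in a step and nothing can be packed into huge numbers. -/

/-- Programs. Registers and arrays are named by numbers. -/
inductive Prog : Type
  /-- do nothing -/
  | skip : Prog
  /-- register `x` becomes the constant `k` -/
  | const (x k : ℕ) : Prog
  /-- register `x` becomes register `y` -/
  | copy (x y : ℕ) : Prog
  /-- add one to register `x` -/
  | inc (x : ℕ) : Prog
  /-- subtract one from register `x` (zero stays zero) -/
  | dec (x : ℕ) : Prog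
  /-- register `x` becomes the entry of array `a` at the index in register `i` -/
  | load (x a i : ℕ) : Prog
  /-- the entry of array `a` at the index in register `i` becomes register `x` -/
  | store (a i x : ℕ) : Prog
  /-- toss a fair coin: register `x` becomes `0` or `1` -/
  | flip (x : ℕ) : Prog
  /-- call the string edit distance subroutine on the first `reg l` entries of array `a` and the
  first `reg m` entries of array `b`; its answer goes to register `x` -/
  | call (x a l b m : ℕ) : Prog
  /-- sequential composition -/
  | seq (p q : Prog) : Prog
  /-- if register `x` is less than register `y` then `p` else `q` -/
  | ifLt (x y : ℕ) (p q : Prog) : Prog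
  /-- if registers `x` and `y` are equal then `p` else `q` -/
  | ifEq (x y : ℕ) (p q : Prog) : Prog
  /-- while register `x` is less than register `y` do `p` -/
  | whileLt (x y : ℕ) (p : Prog) : Prog

/-- Machine states: registers, arrays, and the number of coins tossed so far. -/
structure State : Type where
  reg : ℕ → ℕ
  arr : ℕ → ℕ → ℕ
  coins : ℕ

/-- Write `v` to register `x`. -/
def State.set (S : State) (x v : ℕ) : State :=
  { S with reg := Function.update S.reg x v }

/-- Write `v` to entry `i` of array `a`. -/
def State.setArr (S : State) (a i v : ℕ) : State :=
  { S with arr := Function.update S.arr a (Function.update (S.arr a) i v) }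

/-- The first `l` entries of array `a`. -/
def State.slice (S : State) (a l : ℕ) : List ℕ :=
  (List.range l).map (S.arr a)

/-- `Exec O α ω p S S' t`: started in state `S`, the program `p` halts in state `S'` after `t`
steps, where `O` is the subroutine, a call of which on strings of total length `m` takes `α m + 1`
steps, and `ω` is the sequence of coin tosses. Every other instruction and every test takes one
step. -/
inductive Exec (O : List ℕ → List ℕ → ℕ) (α : ℕ → ℕ) (ω : ℕ → Bool) :
    Prog → State → State → ℕ → Prop
  | skip (S : State) : Exec O α ω .skip S S 1
  | const (S : State) (x k : ℕ) : Exec O α ω (.const x k) S (S.set x k) 1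
  | copy (S : State) (x y : ℕ) : Exec O α ω (.copy x y) S (S.set x (S.reg y)) 1
  | inc (S : State) (x : ℕ) : Exec O α ω (.inc x) S (S.set x (S.reg x + 1)) 1
  | dec (S : State) (x : ℕ) : Exec O α ω (.dec x) S (S.set x (S.reg x - 1)) 1
  | load (S : State) (x a i : ℕ) : Exec O α ω (.load x a i) S (S.set x (S.arr a (S.reg i))) 1
  | store (S : State) (a i x : ℕ) :
      Exec O α ω (.store a i x) S (S.setArr a (S.reg i) (S.reg x)) 1
  | flip (S : State) (x : ℕ) :
      Exec O α ω (.flip x) S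
        { S.set x (if ω S.coins then 1 else 0) with coins := S.coins + 1 } 1
  | call (S : State) (x a l b m : ℕ) :
      Exec O α ω (.call x a l b m) S
        (S.set x (O (S.slice a (S.reg l)) (S.slice b (S.reg m))))
        (α (S.reg l + S.reg m) + 1)
  | seq {p q : Prog} {S S₁ S₂ : State} {t₁ t₂ : ℕ} :
      Exec O α ω p S S₁ t₁ → Exec O α ω q S₁ S₂ t₂ → Exec O α ω (.seq p q) S S₂ (t₁ + t₂)
  | ifLt_true {x y : ℕ} {p q : Prog} {S S' : State} {t : ℕ} :
      S.reg x < S.reg y → Exec O α ω p S S' t → Exec O α ω (.ifLt x y p q) S S' (t + 1)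
  | ifLt_false {x y : ℕ} {p q : Prog} {S S' : State} {t : ℕ} :
      ¬ S.reg x < S.reg y → Exec O α ω q S S' t → Exec O α ω (.ifLt x y p q) S S' (t + 1)
  | ifEq_true {x y : ℕ} {p q : Prog} {S S' : State} {t : ℕ} :
      S.reg x = S.reg y → Exec O α ω p S S' t → Exec O α ω (.ifEq x y p q) S S' (t + 1)
  | ifEq_false {x y : ℕ} {p q : Prog} {S S' : State} {t : ℕ} :
      ¬ S.reg x = S.reg y → Exec O α ω q S S' t → Exec O α ω (.ifEq x y p q) S S' (t + 1)
  | while_done {x y : ℕ} {p : Prog} {S : State} :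
      ¬ S.reg x < S.reg y → Exec O α ω (.whileLt x y p) S S 1
  | while_step {x y : ℕ} {p : Prog} {S S₁ S₂ : State} {t₁ t₂ : ℕ} :
      S.reg x < S.reg y → Exec O α ω p S S₁ t₁ → Exec O α ω (.whileLt x y p) S₁ S₂ t₂ →
        Exec O α ω (.whileLt x y p) S S₂ (t₁ + t₂ + 1)

/-- The initial state for the input `σ`: register `0` holds the length of `σ`, array `0` the kinds
(open or close) of its symbols, array `1` their types; everything else is zero. -/
def initState {s : ℕ} (σ : List (Paren s)) : State where
  reg x := if x = 0 then σ.length else 0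
  arr a i := if a = 0 then (σ.map Paren.kind).getD i 0
    else if a = 1 then (σ.map Paren.type).getD i 0 else 0
  coins := 0

/-- With the coin tosses `ω`, the program `p` halts on input `σ` after `t` steps with output `v`,
which is the final content of register `0`. -/
def Outputs (O : List ℕ → List ℕ → ℕ) (α : ℕ → ℕ) (p : Prog) {s : ℕ} (σ : List (Paren s))
    (ω : ℕ → Bool) (v t : ℕ) : Prop :=
  ∃ S : State, Exec O α ω p (initState σ) S t ∧ S.reg 0 = v

/-- The law of an infinite sequence of independent fair coin tosses. -/
noncomputable def coinLaw : Measure (ℕ → Bool) :=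
  Measure.infinitePi fun _ : ℕ => (PMF.uniformOfFintype Bool).toMeasure

/-- `O` approximates the string edit distance of strings over the alphabet `{0, …, s - 1}`, within
the factor `β m` when their total length is `m`. -/
def ApproxStrEdit (s : ℕ) (β : ℕ → ℝ) (O : List ℕ → List ℕ → ℕ) : Prop :=
  ∀ x y : List ℕ, (∀ a ∈ x, a < s) → (∀ a ∈ y, a < s) →
    strEdit x y ≤ O x y ∧ (O x y : ℝ) ≤ β (x.length + y.length) * strEdit x y

end DyckEdit

open DyckEdit

namespace DyckEdit

/-! No randomness is needed: a program without coin tosses achieves the factor O(β(n)(1 + log z)).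
For d ≥ 2 the number √(log d) is bounded below by a constant, and for d = 1 the required probability
is at most 0.

After cancellation with a stack, the string is reduced in phases. In every block Y X a phase removes
open parentheses from the end of Y together with equally many close ones from the start of X, until
the shorter run is used up. It charges the subroutine's estimate of the edit distance of the two
removed strings, truncated at their common length. At most one kind of symbol survives in each
block, so a new block needs the remains of two old ones and the number of blocks at least halves.
After at most log₂ z + 2 phases no block is left, and the remaining symbols are deleted.

The output is not too small: a removed window can be put back at the cost of an edit distance
(`DyckWithin.insert_window`), so the charges and the final deletions bound the distance to the Dyck
language.

The output is not too large: with deletions only, the distance is at most D = 2d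
(`DyckWithin.deletesWithin`). Removing an adjacent open-close pair, even a mismatched one, does not
increase the deletion distance (`DeletesWithin.remove_pair`), so every phase starts within D
deletions. These are shared among the disjoint windows, and a window that receives j of them has
strings at edit distance at most 2j (`FactorWithin.strEdit_le`). A phase thus costs at most 2β(n)D
(`Scan.phase_spec`), and a string without blocks has length at most D (`DeletesWithin.length_le`).

Apart from the calls, a phase takes linear time. The calls of all phases have total length at most
n, because they consume removed symbols, so superadditivity bounds their time by α(n). -/

variable {s : ℕ}

/-! ### Edits -/

section Edits

variable {A : Type*}

theorem Edits.append {u v u' v' : List A} {j k : ℕ} (h : Edits u v j) (h' : Edits u' v' k) :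
    Edits (u ++ u') (v ++ v') (j + k) := by
  induction h with
  | nil => simpa using h'
  | keep a _ ih => exact ih.keep a
  | subst a b _ ih => rw [Nat.add_right_comm]; exact ih.subst a b
  | delete a _ ih => rw [Nat.add_right_comm]; exact ih.delete a
  | insert b _ ih => rw [Nat.add_right_comm]; exact ih.insert b

/-- An alignment runs from left to right, so a cut of the source also cuts the target and the cost.
This makes room for insertions at the cut. -/
theorem Edits.split {w v : List A} {k : ℕ} (h : Edits w v k) :
    ∀ {x y : List A}, w = x ++ y → ∃ x' y' i j, v = x' ++ y' ∧ i + j = k ∧ Edits x x' i ∧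
      Edits y y' j := by
  induction h with
  | nil =>
    intro x y h
    obtain ⟨rfl, rfl⟩ : x = [] ∧ y = [] := by simpa using h.symm
    exact ⟨[], [], 0, 0, rfl, rfl, .nil, .nil⟩
  | @keep a u v k h ih =>
    intro x y e
    cases x with
    | nil => exact ⟨[], a :: v, 0, k, rfl, by simp, .nil, by simp at e; subst e; exact h.keep a⟩
    | cons c x =>
      obtain ⟨rfl, e'⟩ : a = c ∧ u = x ++ y := by simpa using e
      obtain ⟨x', y', i, j, rfl, rfl, h1, h2⟩ := ih e'
      exact ⟨_ :: x', y', i, j, rfl, rfl, h1.keep _, h2⟩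
  | @subst a b u v k h ih =>
    intro x y e
    cases x with
    | nil => exact ⟨[], b :: v, 0, k + 1, rfl, by simp, .nil, by
        simp at e; subst e; exact h.subst a b⟩
    | cons c x =>
      obtain ⟨rfl, e'⟩ : a = c ∧ u = x ++ y := by simpa using e
      obtain ⟨x', y', i, j, rfl, rfl, h1, h2⟩ := ih e'
      exact ⟨b :: x', y', i + 1, j, rfl, by omega, h1.subst _ _, h2⟩
  | @delete a u v k h ih =>
    intro x y e
    cases x with
    | nil => exact ⟨[], v, 0, k + 1, rfl, by simp, .nil, by
        simp at e; subst e; exact h.delete a⟩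
    | cons c x =>
      obtain ⟨rfl, e'⟩ : a = c ∧ u = x ++ y := by simpa using e
      obtain ⟨x', y', i, j, rfl, rfl, h1, h2⟩ := ih e'
      exact ⟨x', y', i + 1, j, rfl, by omega, h1.delete _, h2⟩
  | @insert b u v k h ih =>
    intro x y e
    obtain ⟨x', y', i, j, rfl, rfl, h1, h2⟩ := ih e
    exact ⟨b :: x', y', i + 1, j, rfl, by omega, h1.insert _, h2⟩

/-- Carries an alignment of the numbers seen by the subroutine back to parenthesis types. -/
theorem Edits.of_map {B : Type*} {f : B → A} (hf : f.Injective) {u v : List A} {k : ℕ}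
    (h : Edits u v k) : ∀ {x y : List B}, u = x.map f → v = y.map f → Edits x y k := by
  induction h with
  | nil =>
    intro x y hx hy
    obtain rfl : x = [] := by simpa using hx.symm
    obtain rfl : y = [] := by simpa using hy.symm
    exact .nil
  | keep a _ ih =>
    intro x y hx hy
    obtain ⟨b, x, rfl, rfl, hx'⟩ := List.map_eq_cons_iff.1 hx.symm
    obtain ⟨c, y, rfl, h, hy'⟩ := List.map_eq_cons_iff.1 hy.symm
    obtain rfl := hf h
    exact (ih hx'.symm hy'.symm).keep _
  | subst a b _ ih =>
    intro x y hx hy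
    obtain ⟨b, x, rfl, rfl, hx'⟩ := List.map_eq_cons_iff.1 hx.symm
    obtain ⟨c, y, rfl, h, hy'⟩ := List.map_eq_cons_iff.1 hy.symm
    exact (ih hx'.symm hy'.symm).subst _ _
  | delete a _ ih =>
    intro x y hx hy
    obtain ⟨b, x, rfl, rfl, hx'⟩ := List.map_eq_cons_iff.1 hx.symm
    exact (ih hx'.symm hy).delete _
  | insert b _ ih =>
    intro x y hx hy
    obtain ⟨c, y, rfl, h, hy'⟩ := List.map_eq_cons_iff.1 hy.symm
    exact (ih hx hy'.symm).insert _

theorem edits_nil_right (u : List A) : Edits u [] u.length := by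
  induction u with
  | nil => exact .nil
  | cons a u ih => exact ih.delete a

theorem edits_nil_left (v : List A) : Edits [] v v.length := by
  induction v with
  | nil => exact .nil
  | cons a u ih => exact ih.insert a

theorem edits_strEdit (u v : List A) : Edits u v (strEdit u v) := by
  refine Nat.sInf_mem (s := {k | Edits u v k}) ⟨u.length + v.length, ?_⟩
  simpa using (edits_nil_right u).append (edits_nil_left v)

theorem strEdit_le {u v : List A} {k : ℕ} (h : Edits u v k) : strEdit u v ≤ k := Nat.sInf_le h

theorem Edits.of_length_eq : ∀ {u v : List A}, u.length = v.length → Edits u v u.length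
  | [], [], _ => .nil
  | a :: _, b :: _, h => (Edits.of_length_eq (by simpa using h)).subst a b

theorem Edits.of_common_sublist {c u v : List A} (hu : c.Sublist u) (hv : c.Sublist v) :
    Edits u v ((u.length - c.length) + (v.length - c.length)) := by
  induction hu generalizing v with
  | slnil => simpa using edits_nil_left v
  | @cons c u a h ih =>
    have := h.length_le
    rw [List.length_cons, show u.length + 1 - c.length + (v.length - c.length) =
      u.length - c.length + (v.length - c.length) + 1 by omega]
    exact (ih hv).delete a
  | @cons_cons c u a h ih =>
    obtain ⟨r₁, r₂, rfl, ha, hr⟩ := List.cons_sublist_iff.1 hv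
    obtain ⟨x, y, rfl⟩ := List.append_of_mem ha
    have := hr.length_le
    have := (edits_nil_left x).append ((ih (hr.trans (List.sublist_append_right y _))).keep a)
    rw [List.append_assoc, List.cons_append]
    have e : (a :: u).length - (a :: c).length + ((x ++ a :: (y ++ r₂)).length - (a :: c).length) =
        x.length + (u.length - c.length + ((y ++ r₂).length - c.length)) := by
      simp only [List.length_append, List.length_cons]
      omega
    rw [e]
    exact this

/-- A string edited with `k` operations keeps a common subsequence. -/
theorem Edits.exists_common_sublist {u v : List A} {k : ℕ} (h : Edits u v k) :
    ∃ c : List A, c.Sublist u ∧ c.Sublist v ∧ u.length + v.length ≤ 2 * c.length + 2 * k := by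
  induction h with
  | nil => exact ⟨[], by simp⟩
  | keep a _ ih =>
    obtain ⟨c, h1, h2, h3⟩ := ih
    exact ⟨a :: c, h1.cons_cons a, h2.cons_cons a, by simp; omega⟩
  | subst a b _ ih =>
    obtain ⟨c, h1, h2, h3⟩ := ih
    exact ⟨c, h1.cons a, h2.cons b, by simp; omega⟩
  | delete a _ ih =>
    obtain ⟨c, h1, h2, h3⟩ := ih
    exact ⟨c, h1.cons a, h2, by simp; omega⟩
  | insert b _ ih =>
    obtain ⟨c, h1, h2, h3⟩ := ih
    exact ⟨c, h1, h2.cons b, by simp; omega⟩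

end Edits

theorem exists_sublist_append {A : Type*} {w u v : List A} (h : w.Sublist (u ++ v)) :
    ∃ u' v', w = u' ++ v' ∧ u'.Sublist u ∧ v'.Sublist v :=
  List.sublist_append_iff.1 h

/-! ### Recognizing well-balanced strings with a stack -/

/-- Read a string, pushing open parentheses and popping congruent ones; `none` on a conflict. -/
def run : List (Fin s) → List (Paren s) → Option (List (Fin s))
  | st, [] => some st
  | st, .opn a :: w => run (a :: st) w
  | [], .cls _ :: _ => none
  | a :: st, .cls b :: w => if a = b then run st w else none

@[simp] theorem run_nil (st : List (Fin s)) : run st [] = some st := by simp [run]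

@[simp] theorem run_opn (st : List (Fin s)) (a : Fin s) (w : List (Paren s)) :
    run st (.opn a :: w) = run (a :: st) w := by simp [run]

theorem run_cls_eq_some {st r : List (Fin s)} {b : Fin s} {w : List (Paren s)} :
    run st (.cls b :: w) = some r ↔ ∃ st', st = b :: st' ∧ run st' w = some r := by
  cases st with
  | nil => simp [run]
  | cons a st => simp only [run]; grind

theorem run_append (st : List (Fin s)) (u v : List (Paren s)) :
    run st (u ++ v) = (run st u).bind fun st' => run st' v := by
  induction u generalizing st with
  | nil => simp
  | cons x u ih =>
    cases x with
    | opn a => simp [ih]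
    | cls b =>
      cases st with
      | nil => simp [run]
      | cons a st => simp only [run, List.cons_append]; split <;> simp [ih]

theorem run_append_eq_some {st r : List (Fin s)} {u v : List (Paren s)} :
    run st (u ++ v) = some r ↔ ∃ m, run st u = some m ∧ run m v = some r := by
  rw [run_append, Option.bind_eq_some_iff]

theorem IsDyck.run_eq {w : List (Paren s)} (h : IsDyck w) : ∀ st, run st w = some st := by
  induction h with
  | nil => simp
  | append _ _ ih₁ ih₂ => intro st; simp [run_append, ih₁, ih₂]
  | wrap a _ ih => intro st; simp [run_append, ih, run]

theorem IsDyck.insert_pair {w : List (Paren s)} (h : IsDyck w) (a : Fin s) :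
    ∀ {u v : List (Paren s)}, w = u ++ v → IsDyck (u ++ .opn a :: .cls a :: v) := by
  induction h with
  | nil =>
    intro u v h
    obtain ⟨rfl, rfl⟩ : u = [] ∧ v = [] := by simpa using h.symm
    exact .wrap a .nil
  | @append x y hx hy ihx ihy =>
    intro u v h
    rcases List.append_eq_append_iff.1 h with ⟨t, rfl, rfl⟩ | ⟨t, rfl, rfl⟩
    · simpa using hx.append (ihy (u := t) (v := v) rfl)
    · simpa using (ihx (u := u) (v := t) rfl).append hy
  | @wrap b x hx ih =>
    intro u v h
    cases u with
    | nil =>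
      obtain rfl : _ = v := by simpa using h
      exact (IsDyck.wrap a .nil).append (.wrap b hx)
    | cons c u =>
      obtain ⟨rfl, h⟩ : Paren.opn b = c ∧ x ++ [.cls b] = u ++ v := by simpa using h
      rcases List.eq_nil_or_concat v with rfl | ⟨v, d, rfl⟩
      · obtain rfl : _ = u := by simpa using h
        simpa using (IsDyck.wrap b hx).append (.wrap a .nil)
      · have h' : x ++ [.cls b] = (u ++ v) ++ [d] := by simpa using h
        obtain ⟨rfl, h'⟩ := List.append_inj' h' rfl
        obtain rfl : _ = d := by simpa using h'
        simpa using IsDyck.wrap b (ih (u := u) (v := v) rfl)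

/-- The stack stands for unmatched open parentheses in front of `w`; undoing a pop inserts a
congruent pair between the two. -/
theorem isDyck_of_run_eq {st : List (Fin s)} {w : List (Paren s)} (h : run st w = some []) :
    IsDyck ((st.map Paren.opn).reverse ++ w) := by
  induction w generalizing st with
  | nil =>
    obtain rfl : st = [] := by simpa using h
    exact .nil
  | cons x w ih =>
    cases x with
    | opn a => simpa using ih h
    | cls b =>
      obtain ⟨st, rfl, h'⟩ := run_cls_eq_some.1 h
      simpa using (ih h').insert_pair b rfl

theorem isDyck_iff_run {w : List (Paren s)} : IsDyck w ↔ run [] w = some [] :=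
  ⟨fun h => h.run_eq [], fun h => by simpa using isDyck_of_run_eq h⟩

/-- Without one of the open parentheses on the stack, one close parenthesis can be left out. -/
theorem exists_sublist_run_of_stack {a : Fin s} {p st : List (Fin s)} {v : List (Paren s)}
    (h : run (p ++ a :: st) v = some []) :
    ∃ v', v'.Sublist v ∧ v.length = v'.length + 1 ∧ run (p ++ st) v' = some [] := by
  induction v generalizing p with
  | nil => simp at h
  | cons x v ih =>
    cases x with
    | opn c =>
      obtain ⟨v', h1, h2, h3⟩ := ih (p := c :: p) (by simpa using h)
      exact ⟨.opn c :: v', h1.cons_cons _, by simp [h2], by simpa using h3⟩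
    | cls b =>
      obtain ⟨m, e, h⟩ := run_cls_eq_some.1 h
      cases p with
      | nil =>
        obtain ⟨rfl, rfl⟩ : a = b ∧ st = m := by simpa using e
        exact ⟨v, List.sublist_cons_self _ _, rfl, h⟩
      | cons c p =>
        obtain ⟨rfl, rfl⟩ : c = b ∧ p ++ a :: st = m := by simpa using e
        obtain ⟨v', h1, h2, h3⟩ := ih h
        exact ⟨.cls c :: v', h1.cons_cons _, by simp [h2], run_cls_eq_some.2 ⟨_, rfl, h3⟩⟩

/-- An open parenthesis that stays on the stack can be left out. -/
theorem exists_sublist_run_to_stack {b : Fin s} {p st : List (Fin s)} {u : List (Paren s)}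
    (h : run [] u = some (p ++ b :: st)) :
    ∃ u', u'.Sublist u ∧ u.length = u'.length + 1 ∧ run [] u' = some (p ++ st) := by
  induction u using List.reverseRecOn generalizing p with
  | nil => simp at h
  | append_singleton u x ih =>
    obtain ⟨m, hm, h⟩ := run_append_eq_some.1 h
    cases x with
    | opn c =>
      obtain rfl | ⟨p', rfl⟩ : p = [] ∨ ∃ p', p = c :: p' := by
        cases p <;> simp_all
      · obtain ⟨rfl, rfl⟩ : c = b ∧ m = st := by simpa using h
        exact ⟨u, by simp, by simp, hm⟩
      · obtain rfl : m = p' ++ b :: st := by simpa using h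
        obtain ⟨u', h1, h2, h3⟩ := ih hm
        exact ⟨u' ++ [.opn c], h1.append (List.Sublist.refl _), by simp [h2],
          by simp [run_append, h3]⟩
    | cls c =>
      obtain ⟨m, rfl, h'⟩ := run_cls_eq_some.1 h
      obtain rfl : m = p ++ b :: st := by simpa using h'
      obtain ⟨u', h1, h2, h3⟩ := ih (p := c :: p) hm
      exact ⟨u' ++ [.cls c], h1.append (List.Sublist.refl _), by simp [h2],
        run_append_eq_some.2 ⟨_, h3, by simp [run]⟩⟩

/-! ### Distances to the Dyck language -/

/-- At most `k` edits turn the string into a well-balanced one. -/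
def DyckWithin (k : ℕ) (w : List (Paren s)) : Prop :=
  ∃ v j, IsDyck v ∧ Edits w v j ∧ j ≤ k

/-- At most `k` deletions turn the string into a well-balanced one. -/
def DeletesWithin (k : ℕ) (w : List (Paren s)) : Prop :=
  ∃ v, v.Sublist w ∧ w.length ≤ v.length + k ∧ IsDyck v

/-- At most `k` deletions turn the string into a factor of a well-balanced one. -/
def FactorWithin (k : ℕ) (w : List (Paren s)) : Prop :=
  ∃ v, v.Sublist w ∧ w.length ≤ v.length + k ∧ ∃ st r, run st v = some r

theorem dyckWithin_length (w : List (Paren s)) : DyckWithin w.length w :=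
  ⟨[], _, .nil, edits_nil_right w, le_rfl⟩

theorem dyckWithin_dyckDist (w : List (Paren s)) : DyckWithin (dyckDist w) w := by
  have : ∃ v, IsDyck v ∧ Edits w v (dyckDist w) :=
    Nat.sInf_mem (s := {k | ∃ v, IsDyck v ∧ Edits w v k}) ⟨_, [], .nil, edits_nil_right w⟩
  obtain ⟨v, h1, h2⟩ := this
  exact ⟨v, _, h1, h2, le_rfl⟩

theorem DyckWithin.dyckDist_le {k : ℕ} {w : List (Paren s)} (h : DyckWithin k w) :
    dyckDist w ≤ k := by
  obtain ⟨v, j, h1, h2, h3⟩ := h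
  exact (Nat.sInf_le (s := {k | ∃ v, IsDyck v ∧ Edits w v k}) ⟨v, h1, h2⟩).trans h3

/-- Each symbol missing from `c` forces out at most one more, its partner. -/
theorem IsDyck.exists_sublist {w c : List (Paren s)} (h : IsDyck w) (hc : c.Sublist w) :
    ∃ v, v.Sublist c ∧ IsDyck v ∧ 2 * c.length ≤ v.length + w.length := by
  induction h generalizing c with
  | nil => exact ⟨[], by simp, .nil, by simpa using hc⟩
  | append _ _ ih₁ ih₂ =>
    obtain ⟨c₁, c₂, rfl, h₁, h₂⟩ := List.sublist_append_iff.1 hc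
    obtain ⟨v₁, hv₁, d₁, l₁⟩ := ih₁ h₁
    obtain ⟨v₂, hv₂, d₂, l₂⟩ := ih₂ h₂
    exact ⟨v₁ ++ v₂, hv₁.append hv₂, d₁.append d₂, by simp; omega⟩
  | @wrap a u _ ih =>
    obtain ⟨c₁, c', rfl, h₁, h'⟩ := exists_sublist_append (u := [Paren.opn a]) hc
    obtain ⟨c₂, c₃, rfl, h₂, h₃⟩ := List.sublist_append_iff.1 h'
    obtain ⟨v, hv, d, l⟩ := ih h₂
    have hl₁ : c₁.length ≤ 1 := by simpa using h₁.length_le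
    have hl₃ : c₃.length ≤ 1 := by simpa using h₃.length_le
    by_cases hb : c₁.length = 1 ∧ c₃.length = 1
    · obtain rfl := h₁.eq_of_length (by simp [hb])
      obtain rfl := h₃.eq_of_length (by simp [hb])
      exact ⟨.opn a :: (v ++ [.cls a]), (hv.append (List.Sublist.refl _)).cons_cons _, .wrap a d,
        by simp; omega⟩
    · exact ⟨v, hv.trans ((List.sublist_append_left _ _).trans (List.sublist_append_right _ _)), d,
        by simp; omega⟩

/-- Of the symbols preserved by the alignment, those that lost their partner are discarded. A
substitution costs its own symbol and one partner, hence the factor 2. -/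
theorem DyckWithin.deletesWithin {k : ℕ} {w : List (Paren s)} (h : DyckWithin k w) :
    DeletesWithin (2 * k) w := by
  obtain ⟨v, j, h1, h2, h3⟩ := h
  obtain ⟨c, cw, cv, hc⟩ := h2.exists_common_sublist
  obtain ⟨x, xc, dx, lx⟩ := h1.exists_sublist cv
  exact ⟨x, xc.trans cw, by omega, dx⟩

theorem DeletesWithin.factorWithin {k : ℕ} {w : List (Paren s)} (h : DeletesWithin k w) :
    FactorWithin k w := by
  obtain ⟨v, h1, h2, h3⟩ := h
  exact ⟨v, h1, h2, [], _, h3.run_eq _⟩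

/-- Pieces of a balanced string need not be balanced, but they are factors of one, and the deletions
in disjoint pieces add up. This lets one budget pay for all windows of a phase. -/
theorem FactorWithin.split {k : ℕ} {u v : List (Paren s)} (h : FactorWithin k (u ++ v)) :
    ∃ i j, i + j ≤ k ∧ FactorWithin i u ∧ FactorWithin j v := by
  obtain ⟨x, hx, l, st, r, e⟩ := h
  obtain ⟨y, z, rfl, hy, hz⟩ := List.sublist_append_iff.1 hx
  obtain ⟨m, e₁, e₂⟩ := run_append_eq_some.1 e
  have := hy.length_le
  have := hz.length_le
  simp only [List.length_append] at l
  exact ⟨u.length - y.length, v.length - z.length, by omega, ⟨y, hy, by omega, st, m, e₁⟩,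
    ⟨z, hz, by omega, m, r, e₂⟩⟩

/-- Removing an open parenthesis directly followed by a close one, congruent or not, does not
increase the number of deletions needed. -/
theorem DeletesWithin.remove_pair {k : ℕ} {u v : List (Paren s)} {a b : Fin s}
    (h : DeletesWithin k (u ++ .opn a :: .cls b :: v)) : DeletesWithin k (u ++ v) := by
  obtain ⟨x, hx, l, d⟩ := h
  obtain ⟨u', x, rfl, hu, hx⟩ := List.sublist_append_iff.1 hx
  obtain ⟨y, v', rfl, hy, hv⟩ := exists_sublist_append (u := [Paren.opn a, Paren.cls b]) hx
  obtain ⟨m, e₁, e₂⟩ := run_append_eq_some.1 (isDyck_iff_run.1 d)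
  have hu' := hu.length_le
  have hv' := hv.length_le
  simp only [List.length_append, List.length_cons] at l
  have hy' : y = [] ∨ y = [.opn a] ∨ y = [.cls b] ∨ y = [.opn a, .cls b] := by
    have := List.mem_sublists.2 hy
    simpa [List.sublists, or_assoc, or_comm, or_left_comm] using this
  -- If exactly one symbol of the pair survives, its partner elsewhere is deleted, paid for by the
  -- deletion of the other symbol of the pair, which is no longer needed. If both survive, they
  -- match each other.
  rcases hy' with rfl | rfl | rfl | rfl
  · exact ⟨u' ++ v', hu.append hv, by simp at *; omega,
      isDyck_iff_run.2 (run_append_eq_some.2 ⟨m, e₁, by simpa using e₂⟩)⟩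
  · obtain ⟨v'', h1, h2, h3⟩ := exists_sublist_run_of_stack (p := []) (by simpa using e₂)
    exact ⟨u' ++ v'', hu.append (h1.trans hv), by simp at *; omega,
      isDyck_iff_run.2 (run_append_eq_some.2 ⟨m, e₁, h3⟩)⟩
  · obtain ⟨m, rfl, e₃⟩ := run_cls_eq_some.1 e₂
    obtain ⟨u'', h1, h2, h3⟩ := exists_sublist_run_to_stack (p := []) (by simpa using e₁)
    exact ⟨u'' ++ v', (h1.trans hu).append hv, by simp at *; omega,
      isDyck_iff_run.2 (run_append_eq_some.2 ⟨m, h3, e₃⟩)⟩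
  · obtain ⟨m', e, e₂⟩ := run_cls_eq_some.1 e₂
    obtain ⟨rfl, rfl⟩ : a = b ∧ m = m' := by simpa using e
    exact ⟨u' ++ v', hu.append hv, by simp at *; omega,
      isDyck_iff_run.2 (run_append_eq_some.2 ⟨m, e₁, e₂⟩)⟩

theorem DyckWithin.insert_pair {k : ℕ} {u v : List (Paren s)} (h : DyckWithin k (u ++ v))
    (a : Fin s) : DyckWithin k (u ++ .opn a :: .cls a :: v) := by
  obtain ⟨w, j, d, e, l⟩ := h
  obtain ⟨u', v', i, j, rfl, rfl, e₁, e₂⟩ := e.split rfl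
  exact ⟨_, _, d.insert_pair a rfl, e₁.append ((e₂.keep _).keep _), l⟩

theorem DyckWithin.insert_pair' {k : ℕ} {u v : List (Paren s)} (h : DyckWithin k (u ++ v))
    (a b : Fin s) : DyckWithin (k + 1) (u ++ .opn a :: .cls b :: v) := by
  obtain ⟨w, j, d, e, l⟩ := h
  obtain ⟨u', v', i, j, rfl, rfl, e₁, e₂⟩ := e.split rfl
  exact ⟨_, _, d.insert_pair a rfl, e₁.append ((e₂.subst _ _).keep _), by omega⟩

theorem DyckWithin.insert_one {k : ℕ} {u v : List (Paren s)} (h : DyckWithin k (u ++ v))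
    (x : Paren s) : DyckWithin (k + 1) (u ++ x :: v) := by
  obtain ⟨w, j, d, e, l⟩ := h
  obtain ⟨u', v', i, j, rfl, rfl, e₁, e₂⟩ := e.split rfl
  exact ⟨_, _, d, e₁.append (e₂.delete _), by omega⟩

/-- The string in which open parentheses of the types `A`, from right to left, are followed by
close parentheses of the types `B`, from left to right. -/
def window (A B : List (Fin s)) : List (Paren s) :=
  (A.map Paren.opn).reverse ++ B.map Paren.cls

/-- The heads of `A` and `B` meet in the middle of the window, so each operation of the alignment is
an insertion there: a kept symbol is a congruent pair at no cost, a substitution an arbitrary pair,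
a deletion or insertion a single parenthesis. -/
theorem DyckWithin.insert_window {A B : List (Fin s)} {j : ℕ} (h : Edits A B j) {k : ℕ}
    {u v : List (Paren s)} (hk : DyckWithin k (u ++ v)) :
    DyckWithin (k + j) (u ++ window A B ++ v) := by
  induction h with
  | nil => simpa [window] using hk
  | @keep a A B j _ ih =>
    have := DyckWithin.insert_pair (u := u ++ (A.map Paren.opn).reverse)
      (v := B.map Paren.cls ++ v) (by simpa [window] using ih) a
    simpa [window] using this
  | @subst a b A B j _ ih =>
    have := DyckWithin.insert_pair' (u := u ++ (A.map Paren.opn).reverse)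
      (v := B.map Paren.cls ++ v) (by simpa [window] using ih) a b
    simpa [window, Nat.add_assoc] using this
  | @delete a A B j _ ih =>
    have := DyckWithin.insert_one (u := u ++ (A.map Paren.opn).reverse)
      (v := B.map Paren.cls ++ v) (by simpa [window] using ih) (.opn a)
    simpa [window, Nat.add_assoc] using this
  | @insert b A B j _ ih =>
    have := DyckWithin.insert_one (u := u ++ (A.map Paren.opn).reverse)
      (v := B.map Paren.cls ++ v) (by simpa [window] using ih) (.cls b)
    simpa [window, Nat.add_assoc] using this

theorem run_map_opn (st A : List (Fin s)) :
    run st (A.map Paren.opn).reverse = some (A ++ st) := by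
  induction A generalizing st with
  | nil => simp
  | cons a A ih => simp [run_append, ih]

theorem eq_append_of_run_map_cls {st r B : List (Fin s)}
    (h : run st (B.map Paren.cls) = some r) : st = B ++ r := by
  induction B generalizing st with
  | nil => simpa using h
  | cons b B ih =>
    obtain ⟨m, rfl, h'⟩ := run_cls_eq_some.1 h
    simp [ih h']

/-- Just before the surviving close parentheses `B'` are read, the stack is both `A'.reverse ++ st`
and `B' ++ r`. Hence one of `A'.reverse` and `B'` is a prefix of the other, and the shorter is a
common subsequence of `A` and `B`. As these have equal length, each of them misses the same number
of symbols, at most `k`. -/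
theorem FactorWithin.strEdit_le {k : ℕ} {A B : List (Fin s)} (hAB : A.length = B.length)
    (h : FactorWithin k (window A B)) {T : Type*} (f : Fin s → T) :
    strEdit (A.map f) (B.map f) ≤ 2 * k := by
  obtain ⟨x, hx, l, st, r, e⟩ := h
  obtain ⟨y, z, rfl, hy, hz⟩ := List.sublist_append_iff.1 hx
  rw [← List.map_reverse, List.sublist_map_iff] at hy
  obtain ⟨A', hA, rfl⟩ := hy
  obtain ⟨B', hB, rfl⟩ := List.sublist_map_iff.1 hz
  obtain ⟨m, e₁, e₂⟩ := run_append_eq_some.1 e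
  have e₁' := run_map_opn st A'.reverse
  rw [List.map_reverse, List.reverse_reverse, e₁] at e₁'
  have e₃ := eq_append_of_run_map_cls e₂
  obtain rfl := Option.some.inj e₁'
  have hA' : A'.reverse.Sublist A := by simpa using hA.reverse
  have lA := hA'.length_le
  have lB := hB.length_le
  simp only [window, List.length_append, List.length_map, List.length_reverse] at l lA
  obtain ⟨c, cA, cB, lc⟩ : ∃ c : List (Fin s), c.Sublist A'.reverse ∧ c.Sublist B' ∧
      (c.length = A'.length ∨ c.length = B'.length) := by
    rcases List.append_eq_append_iff.1 e₃ with ⟨t, rfl, -⟩ | ⟨t, ht, -⟩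
    · exact ⟨A'.reverse, .refl _, by simp, by simp⟩
    · exact ⟨B', by simp [ht], .refl _, by simp⟩
  have := DyckEdit.strEdit_le (Edits.of_common_sublist ((cA.trans hA').map f) ((cB.trans hB).map f))
  simp only [List.length_map] at this
  have := (cA.trans hA').length_le
  omega

/-! ### Removal of well-formed substrings -/

theorem cancelStep_opn (st : List (Paren s)) (a : Fin s) :
    cancelStep st (.opn a) = .opn a :: st := by
  simp [cancelStep]

theorem cancelStep_cases (st : List (Paren s)) (x : Paren s) :
    cancelStep st x = x :: st ∨
      ∃ a, x = .cls a ∧ st = .opn a :: cancelStep st x := by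
  cases x with
  | opn a => exact .inl (cancelStep_opn st a)
  | cls b =>
    match st with
    | [] => simp [cancelStep]
    | .cls c :: st => simp [cancelStep]
    | .opn a :: st =>
      by_cases h : a = b
      · exact .inr ⟨b, rfl, by simp [cancelStep, h]⟩
      · simp [cancelStep, h]

/-- Only congruent pairs are cancelled, and these can be put back at no cost. -/
theorem dyckWithin_of_foldl_cancelStep {k : ℕ} {w : List (Paren s)} :
    ∀ {st : List (Paren s)}, DyckWithin k (w.foldl cancelStep st).reverse →
      DyckWithin k (st.reverse ++ w) := by
  induction w with
  | nil => simp
  | cons x w ih =>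
    intro st h
    have := ih h
    rcases cancelStep_cases st x with e | ⟨a, rfl, e⟩
    · rw [e] at this
      simpa using this
    · rw [e]
      simpa using this.insert_pair a

theorem deletesWithin_foldl_cancelStep {k : ℕ} {w : List (Paren s)} :
    ∀ {st : List (Paren s)}, DeletesWithin k (st.reverse ++ w) →
      DeletesWithin k (w.foldl cancelStep st).reverse := by
  induction w with
  | nil => simp
  | cons x w ih =>
    intro st h
    refine ih ?_
    rcases cancelStep_cases st x with e | ⟨a, rfl, e⟩
    · rw [e]
      simpa using h
    · rw [e] at h
      exact DeletesWithin.remove_pair (a := a) (b := a) (by simpa using h)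

theorem DyckWithin.of_cancel {k : ℕ} {w : List (Paren s)} (h : DyckWithin k (cancel w)) :
    DyckWithin k w := by
  simpa using dyckWithin_of_foldl_cancelStep (st := []) h

theorem DeletesWithin.cancel {k : ℕ} {w : List (Paren s)} (h : DeletesWithin k w) :
    DeletesWithin k (cancel w) :=
  deletesWithin_foldl_cancelStep (st := []) (by simpa using h)

theorem length_foldl_cancelStep_le (w : List (Paren s)) :
    ∀ st : List (Paren s), (w.foldl cancelStep st).length ≤ st.length + w.length := by
  induction w with
  | nil => simp
  | cons x w ih =>
    intro st
    have := ih (cancelStep st x)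
    have h : (cancelStep st x).length ≤ st.length + 1 := by
      rcases cancelStep_cases st x with e | ⟨a, rfl, e⟩
      · rw [e]; simp
      · have := congrArg List.length e
        simp at this
        omega
    simp only [List.foldl_cons, List.length_cons]
    omega

/-! ### Counting blocks -/

/-- `1` if the last symbol of the string is an open parenthesis, `0` otherwise. -/
def lastOpen (w : List (Paren s)) : ℕ :=
  match w.getLast? with
  | some (.opn _) => 1
  | _ => 0

theorem lastOpen_le_one (w : List (Paren s)) : lastOpen w ≤ 1 := by
  unfold lastOpen; split <;> simp

@[simp] theorem lastOpen_nil : lastOpen ([] : List (Paren s)) = 0 := rfl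

@[simp] theorem lastOpen_append_opn (w : List (Paren s)) (a : Fin s) :
    lastOpen (w ++ [.opn a]) = 1 := by simp [lastOpen]

@[simp] theorem lastOpen_append_cls (w : List (Paren s)) (a : Fin s) :
    lastOpen (w ++ [.cls a]) = 0 := by simp [lastOpen]

theorem numBlocks_cons_cons (x y : Paren s) (w : List (Paren s)) :
    numBlocks (x :: y :: w) =
      numBlocks (y :: w) + if x.kind = 0 ∧ y.kind = 1 then 1 else 0 := by
  simp [numBlocks, List.countP_cons]

theorem numBlocks_append_singleton (w : List (Paren s)) (x : Paren s) :
    numBlocks (w ++ [x]) = numBlocks w + if x.kind = 1 then lastOpen w else 0 := by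
  induction w with
  | nil => simp [numBlocks]
  | cons y w ih =>
    cases w with
    | nil => cases y <;> cases x <;> simp [numBlocks, lastOpen, Paren.kind]
    | cons z w =>
      have : lastOpen (y :: z :: w) = lastOpen (z :: w) := by simp [lastOpen]
      rw [this, List.cons_append, List.cons_append, numBlocks_cons_cons, numBlocks_cons_cons,
        ← List.cons_append, ih]
      omega

@[simp] theorem numBlocks_nil : numBlocks ([] : List (Paren s)) = 0 := rfl

@[simp] theorem numBlocks_append_opn (w : List (Paren s)) (a : Fin s) :
    numBlocks (w ++ [.opn a]) = numBlocks w := by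
  simp [numBlocks_append_singleton, Paren.kind]

@[simp] theorem numBlocks_append_cls (w : List (Paren s)) (a : Fin s) :
    numBlocks (w ++ [.cls a]) = numBlocks w + lastOpen w := by
  simp [numBlocks_append_singleton, Paren.kind]

theorem numBlocks_append_opns (w : List (Paren s)) (A : List (Fin s)) :
    numBlocks (w ++ (A.map Paren.opn).reverse) = numBlocks w := by
  induction A with
  | nil => simp
  | cons a A ih => simp [← List.append_assoc, ih]

theorem lastOpen_append_opns (w : List (Paren s)) {A : List (Fin s)} (hA : A ≠ []) :
    lastOpen (w ++ (A.map Paren.opn).reverse) = 1 := by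
  cases A with
  | nil => exact absurd rfl hA
  | cons a A => simp [← List.append_assoc]

theorem numBlocks_le_append (w v : List (Paren s)) : numBlocks w ≤ numBlocks (w ++ v) := by
  induction v using List.reverseRecOn with
  | nil => simp
  | append_singleton v x ih =>
    rw [← List.append_assoc, numBlocks_append_singleton]
    omega

theorem numBlocks_append_clss (w : List (Paren s)) {B : List (Fin s)} (hB : B ≠ []) :
    numBlocks (w ++ B.map Paren.cls) = numBlocks w + lastOpen w ∧
      lastOpen (w ++ B.map Paren.cls) = 0 := by
  induction B using List.reverseRecOn with
  | nil => exact absurd rfl hB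
  | append_singleton B b ih =>
    by_cases h : B = []
    · simp [h]
    · obtain ⟨h1, h2⟩ := ih h
      simp [← List.append_assoc, h1, h2]

theorem numBlocks_append_window (w : List (Paren s)) (Y : List (Fin s)) {A B : List (Fin s)}
    (hA : A ≠ []) (hB : B ≠ []) :
    numBlocks (w ++ (Y.map Paren.opn).reverse ++ window A B) = numBlocks w + 1 := by
  rw [window, ← List.append_assoc, (numBlocks_append_clss _ hB).1, numBlocks_append_opns,
    numBlocks_append_opns, lastOpen_append_opns _ hA]

theorem one_le_numBlocks {a b : Fin s} {w : List (Paren s)}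
    (h : [Paren.opn a, .cls b].Sublist w) : 1 ≤ numBlocks w := by
  -- Strengthened for the induction from the right: once an open parenthesis has occurred, either
  -- there is a block already or the last symbol is open and the next close one completes a block.
  have key : ∀ w : List (Paren s), ([Paren.opn a].Sublist w → 1 ≤ numBlocks w + lastOpen w) ∧
      ([Paren.opn a, .cls b].Sublist w → 1 ≤ numBlocks w) := by
    intro w
    induction w using List.reverseRecOn with
    | nil => simp
    | append_singleton w x ih =>
      obtain ⟨ih₁, ih₂⟩ := ih
      constructor
      · intro h
        cases x with
        | opn c => simp
        | cls c =>
          have : [Paren.opn a].Sublist w := by simpa using h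
          simpa using ih₁ this
      · intro h
        rw [← List.reverse_sublist] at h
        simp only [List.reverse_append, List.reverse_cons, List.reverse_nil, List.nil_append,
          List.singleton_append] at h
        cases x with
        | opn c =>
          rw [List.cons_sublist_cons'] at h
          have h : ([Paren.opn a, Paren.cls b].reverse).Sublist w.reverse := by simpa using h
          simpa using ih₂ (List.reverse_sublist.1 h)
        | cls c =>
          rw [List.cons_sublist_cons'] at h
          have := lastOpen_le_one w
          rcases h with h | ⟨-, h⟩
          · have := ih₂ (List.reverse_sublist.1 (by simpa using h))
            simp; omega
          · simpa using ih₁ (by simpa using h)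
  exact (key w).2 h

theorem IsDyck.eq_nil_or_exists {w : List (Paren s)} (h : IsDyck w) :
    w = [] ∨ ∃ a b, [Paren.opn a, .cls b].Sublist w := by
  induction h with
  | nil => simp
  | @append u v _ _ ih₁ ih₂ =>
    rcases ih₁ with rfl | ⟨a, b, h⟩
    · simpa using ih₂
    · exact .inr ⟨a, b, h.trans (List.sublist_append_left u v)⟩
  | wrap a _ _ => exact .inr ⟨a, a, by simp⟩

/-- Without blocks no open parenthesis precedes a close one, so the only balanced subsequence is
empty. -/
theorem DeletesWithin.length_le {k : ℕ} {w : List (Paren s)} (h : DeletesWithin k w)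
    (hw : numBlocks w = 0) : w.length ≤ k := by
  obtain ⟨v, h1, h2, h3⟩ := h
  rcases h3.eq_nil_or_exists with rfl | ⟨a, b, h⟩
  · simpa using h2
  · have := one_le_numBlocks (h.trans h1)
    omega

/-! ### A phase: every block loses its shorter run -/

/-- The state of a phase: the kept symbols before the current block, the open parentheses of
the block, the open parentheses and the close ones removed from it, and the cost so far. -/
structure Scan (s : ℕ) : Type where
  kept : List (Paren s)
  opens : List (Fin s)
  left : List (Fin s)
  right : List (Fin s)
  cost : ℕ

namespace Scan

variable (c : List (Fin s) → List (Fin s) → ℕ)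

/-- The kept symbols, the last one first. -/
def stack (S : Scan s) : List (Paren s) := S.opens.map Paren.opn ++ S.kept

/-- The cost after the current block has been accounted for. -/
def total (S : Scan s) : ℕ := S.cost + c S.left S.right

/-- Begin a new block if symbols of the current one have been removed. -/
def flush (S : Scan s) : Scan s :=
  if S.left = [] then S else ⟨S.stack, [], [], [], S.total c⟩

/-- Read one symbol. -/
def step (S : Scan s) : Paren s → Scan s
  | .opn a => { S.flush c with opens := a :: (S.flush c).opens }
  | .cls b =>
    match S.opens with
    | [] => { S.flush c with kept := .cls b :: (S.flush c).kept }
    | a :: Y => { S with opens := Y, left := S.left ++ [a], right := S.right ++ [b] }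

/-- The state at the begin of a phase. -/
def start (s : ℕ) : Scan s := ⟨[], [], [], [], 0⟩

/-- The state at the end of a phase. -/
def scan (w : List (Paren s)) : Scan s := w.foldl (step c) (start s)

/-- The string that a phase leaves. -/
def rest (w : List (Paren s)) : List (Paren s) := (scan c w).stack.reverse

/-- The cost of a phase. -/
def charge (w : List (Paren s)) : ℕ := (scan c w).total c

theorem scan_append_singleton (w : List (Paren s)) (x : Paren s) :
    scan c (w ++ [x]) = (scan c w).step c x := by simp [scan]

variable {c} in
theorem stack_flush (S : Scan s) : (S.flush c).stack = S.stack := by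
  unfold flush; split <;> simp [stack]

variable {c} in
theorem opens_flush {S : Scan s} (h : S.opens = []) : (S.flush c).opens = [] := by
  unfold flush; split <;> simp [h]

variable {c} in
theorem stack_step_opn (S : Scan s) (a : Fin s) :
    (S.step c (.opn a)).stack = .opn a :: S.stack := by
  rw [← stack_flush (c := c) S]; simp [step, stack]

variable {c} in
theorem stack_step_cls {S : Scan s} (h : S.opens = []) (b : Fin s) :
    (S.step c (.cls b)).stack = .cls b :: S.stack := by
  rw [← stack_flush (c := c) S]; simp [step, stack, h, opens_flush h]

theorem deletesWithin_foldl_step {k : ℕ} {w : List (Paren s)} :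
    ∀ {S : Scan s}, DeletesWithin k (S.stack.reverse ++ w) →
      DeletesWithin k (w.foldl (step c) S).stack.reverse := by
  induction w with
  | nil => simp
  | cons x w ih =>
    intro S h
    refine ih ?_
    cases x with
    | opn a =>
      rw [stack_step_opn]
      simpa using h
    | cls b =>
      obtain ⟨K, Y, A, B, q⟩ := S
      cases Y with
      | nil =>
        rw [stack_step_cls rfl]
        simpa [stack] using h
      | cons a Y =>
        exact DeletesWithin.remove_pair (a := a) (b := b) (by simpa [step, stack] using h)

theorem deletesWithin_rest {k : ℕ} {w : List (Paren s)} (h : DeletesWithin k w) :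
    DeletesWithin k (rest c w) :=
  deletesWithin_foldl_step c (S := start s) (by simpa [stack, start] using h)

/-- What is known after the string `w` has been read: the part before the current block is `u`. -/
structure Inv (b : ℝ) (u : List (Paren s)) (S : Scan s) : Prop where
  length_eq : S.left.length = S.right.length
  cost_le : ∀ k, FactorWithin k u → (S.cost : ℝ) ≤ 2 * b * k
  dyck : ∀ k v, DyckWithin k (S.kept.reverse ++ v) → DyckWithin (k + S.cost) (u ++ v)
  blocks : 2 * numBlocks S.kept.reverse + lastOpen S.kept.reverse ≤ numBlocks u
  closed : S.opens = [] → S.left = [] → lastOpen S.kept.reverse = 0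
  removed : S.kept.reverse = u ∨ S.kept.length < u.length ∧ 1 ≤ numBlocks u

/-- The symbols read in the current block. -/
def current (S : Scan s) : List (Paren s) :=
  (S.opens.map Paren.opn).reverse ++ window S.left S.right

theorem FactorWithin.mono {k : ℕ} {u v : List (Paren s)} (h : FactorWithin k (u ++ v)) :
    FactorWithin k u := by
  obtain ⟨i, j, hij, ⟨x, h1, h2, h3⟩, -⟩ := h.split
  exact ⟨x, h1, by omega, h3⟩

variable {c} {b : ℝ}

theorem dyckWithin_total {u : List (Paren s)} {S : Scan s}
    (hlow : ∀ A B : List (Fin s), A.length = B.length → ∃ j ≤ c A B, Edits A B j)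
    (h : Inv b u S) {k : ℕ} {v : List (Paren s)} (hk : DyckWithin k (S.stack.reverse ++ v)) :
    DyckWithin (k + S.total c) (u ++ S.current ++ v) := by
  obtain ⟨j, hj, e⟩ := hlow _ _ h.length_eq
  have := (h.dyck k ((S.opens.map Paren.opn).reverse ++ v) (by simpa [stack] using hk))
  rw [← List.append_assoc] at this
  obtain ⟨w, i, h1, h2, h3⟩ := this.insert_window e
  exact ⟨w, i, h1, by simpa [current] using h2, by unfold total; omega⟩

/-- The deletions before the window pay for the cost so far, those inside it for the pending charge.
-/
theorem total_le {u : List (Paren s)} {S : Scan s} (hb : 0 ≤ b)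
    (hup : (c S.left S.right : ℝ) ≤
      b * strEdit (S.left.map Fin.val) (S.right.map Fin.val))
    (h : Inv b u S) {k : ℕ} (hk : FactorWithin k (u ++ S.current)) :
    (S.total c : ℝ) ≤ 2 * b * k := by
  rw [current, ← List.append_assoc] at hk
  obtain ⟨i, j, hij, h1, h2⟩ := hk.split
  have e1 := h.cost_le i (FactorWithin.mono h1)
  have e2 : (strEdit (S.left.map Fin.val) (S.right.map Fin.val) : ℝ) ≤ 2 * j := by
    exact_mod_cast h2.strEdit_le h.length_eq Fin.val
  have e3 : (i : ℝ) + j ≤ k := by exact_mod_cast hij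
  unfold total
  push_cast
  nlinarith

theorem Inv.length_kept_le {u : List (Paren s)} {S : Scan s} (h : Inv b u S) :
    S.kept.length ≤ u.length := by
  rcases h.removed with e | e
  · rw [← e]; simp
  · exact e.1.le

theorem Inv.numBlocks_current {u : List (Paren s)} {S : Scan s} (h : Inv b u S)
    (hl : S.left ≠ []) : numBlocks (u ++ S.current) = numBlocks u + 1 := by
  have hr : S.right ≠ [] := by
    intro e
    have := h.length_eq
    simp [e, hl] at this
  rw [current, ← List.append_assoc, numBlocks_append_window _ _ hl hr]

/-- The left side of `blocks` is a potential. A completed block adds one to `numBlocks u`, and its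
remains raise the potential by at most one: kept open parentheses make `lastOpen` equal to 1, and a
kept close one turns `lastOpen` into a block. By `closed`, a close parenthesis met while no block is
in progress follows no kept open one, so it raises nothing. -/
theorem Inv.step {u : List (Paren s)} {S : Scan s} (hb : 0 ≤ b)
    (hlow : ∀ A B : List (Fin s), A.length = B.length → ∃ j ≤ c A B, Edits A B j)
    (hup : (c S.left S.right : ℝ) ≤
      b * strEdit (S.left.map Fin.val) (S.right.map Fin.val))
    (h : Inv b u S) (x : Paren s) :
    ∃ u', u ++ S.current ++ [x] = u' ++ (S.step c x).current ∧ Inv b u' (S.step c x) := by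
  have hk := h.length_kept_le
  have hl := h.length_eq
  have htotal := fun k => total_le hb hup h (k := k)
  have hdyck := fun k v => dyckWithin_total hlow h (k := k) (v := v)
  have hnb := h.numBlocks_current
  obtain ⟨K, Y, A, B, q⟩ := S
  have hblocks := h.blocks
  have hone := lastOpen_le_one K.reverse
  -- Here no pair has been removed since the last flush, so nothing is charged and `u` can grow only
  -- by a kept close parenthesis.
  by_cases hA : A = []
  · obtain rfl : B = [] := by simpa [hA] using hl.symm
    subst hA
    cases x with
    | opn a =>
      refine ⟨u, by simp [current, Scan.step, flush, window], ?_⟩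
      exact ⟨rfl, h.cost_le, h.dyck, h.blocks, by simp [Scan.step], h.removed⟩
    | cls b' =>
      cases Y with
      | nil =>
        have hcl : lastOpen K.reverse = 0 := h.closed rfl rfl
        refine ⟨u ++ [.cls b'], by simp [current, Scan.step, flush, window], ?_⟩
        refine ⟨rfl, fun k hk => h.cost_le k (FactorWithin.mono hk), ?_, ?_, ?_, ?_⟩
        · intro k v hv
          have := h.dyck k (.cls b' :: v) (by simpa [Scan.step, flush] using hv)
          simpa [Scan.step, flush] using this
        · have := numBlocks_le_append u [.cls b']
          simp only [Scan.step, flush, if_true, List.reverse_cons, numBlocks_append_cls,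
            lastOpen_append_cls]
          dsimp only at hblocks
          omega
        · simp [Scan.step, flush]
        · rcases h.removed with e | ⟨e₁, e₂⟩
          · left
            simpa [Scan.step, flush] using e
          · right
            have := numBlocks_le_append u [.cls b']
            exact ⟨by simpa [Scan.step, flush] using e₁, e₂.trans this⟩
      | cons a Y =>
        refine ⟨u, by simp [current, Scan.step, window], ?_⟩
        exact ⟨rfl, h.cost_le, h.dyck, h.blocks, by simp [Scan.step], h.removed⟩
  · have hnb := hnb hA
    have hlen : (Y.length + K.length) < (u ++ (⟨K, Y, A, B, q⟩ : Scan s).current).length := by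
      have := List.length_pos_of_ne_nil hA
      simp only [current, window, List.length_append, List.length_reverse, List.length_map]
      dsimp only at hk
      omega
    dsimp only at hblocks
    cases x with
    | opn a =>
      refine ⟨u ++ (⟨K, Y, A, B, q⟩ : Scan s).current,
        by simp [current, Scan.step, flush, window, hA], ?_⟩
      refine ⟨by simp [Scan.step, flush, hA], ?_, ?_, ?_, by simp [Scan.step], ?_⟩
      · simpa [Scan.step, flush, hA] using htotal
      · simpa [Scan.step, flush, hA] using hdyck
      · rw [hnb]
        have := lastOpen_le_one (K.reverse ++ (Y.map Paren.opn).reverse)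
        simp only [Scan.step, flush, hA, if_false, stack, List.reverse_append,
          numBlocks_append_opns]
        omega
      · right
        refine ⟨by simpa [Scan.step, flush, hA, stack] using hlen, by omega⟩
    | cls b' =>
      cases Y with
      | nil =>
        refine ⟨u ++ (⟨K, [], A, B, q⟩ : Scan s).current ++ [.cls b'],
          by simp [current, Scan.step, flush, window, hA], ?_⟩
        have hmono := numBlocks_le_append (u ++ (⟨K, [], A, B, q⟩ : Scan s).current) [.cls b']
        refine ⟨by simp [Scan.step, flush, hA], ?_, ?_, ?_, ?_, ?_⟩
        · intro k hk
          simpa [Scan.step, flush, hA] using htotal k (FactorWithin.mono hk)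
        · intro k v hv
          have := hdyck k (.cls b' :: v) (by simpa [Scan.step, flush, hA, stack] using hv)
          simpa [Scan.step, flush, hA] using this
        · simp only [Scan.step, flush, hA, if_false, stack, List.map_nil, List.nil_append,
            List.reverse_cons, numBlocks_append_cls, lastOpen_append_cls]
          simp only [numBlocks_append_cls] at hmono
          omega
        · simp [Scan.step, flush, hA]
        · right
          refine ⟨?_, by omega⟩
          simp only [Scan.step, flush, hA, if_false, stack, List.map_nil, List.nil_append,
            List.length_cons, List.length_append, List.length_nil] at hlen ⊢
          omega
      | cons a Y =>
        refine ⟨u, by simp [current, Scan.step, window], ?_⟩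
        exact ⟨by simpa [Scan.step] using hl, h.cost_le, h.dyck, h.blocks, by simp [Scan.step],
          h.removed⟩

theorem exists_inv {N : ℕ} (hb : 0 ≤ b)
    (hlow : ∀ A B : List (Fin s), A.length = B.length → ∃ j ≤ c A B, Edits A B j)
    (hup : ∀ A B : List (Fin s), A.length + B.length ≤ N →
      (c A B : ℝ) ≤ b * strEdit (A.map Fin.val) (B.map Fin.val)) (w : List (Paren s))
    (hw : w.length ≤ N) :
    ∃ u, w = u ++ (scan c w).current ∧ Inv b u (scan c w) ∧
      (c (scan c w).left (scan c w).right : ℝ) ≤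
        b * strEdit ((scan c w).left.map Fin.val) ((scan c w).right.map Fin.val) := by
  induction w using List.reverseRecOn with
  | nil =>
    refine ⟨[], by simp [scan, start, current, window], ?_, ?_⟩
    · exact ⟨rfl, fun k _ => by simp [scan, start]; positivity, by simp [scan, start], by simp [scan, start],
        by simp [scan, start], by simp [scan, start]⟩
    · exact hup _ _ (by simp [scan, start])
  | append_singleton w x ih =>
    obtain ⟨u, hu, h, hc⟩ := ih (by simp at hw; omega)
    obtain ⟨u', hu', h'⟩ := h.step hb hlow hc x
    rw [scan_append_singleton]
    have e : w ++ [x] = u' ++ ((scan c w).step c x).current := by rw [← hu', ← hu]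
    refine ⟨u', e, h', hup _ _ ?_⟩
    have := congrArg List.length e
    simp only [current, window, List.length_append, List.length_reverse, List.length_map] at this
    simp only [List.length_append] at hw
    omega

/-- The properties of a phase. -/
theorem phase_spec {N : ℕ} (hb : 0 ≤ b)
    (hlow : ∀ A B : List (Fin s), A.length = B.length → ∃ j ≤ c A B, Edits A B j)
    (hup : ∀ A B : List (Fin s), A.length + B.length ≤ N →
      (c A B : ℝ) ≤ b * strEdit (A.map Fin.val) (B.map Fin.val)) {w : List (Paren s)}
    (hw : w.length ≤ N) :
    (∀ k, FactorWithin k w → (charge c w : ℝ) ≤ 2 * b * k) ∧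
    (∀ k, DyckWithin k (rest c w) → DyckWithin (k + charge c w) w) ∧
    2 * numBlocks (rest c w) ≤ numBlocks w ∧
    (rest c w = w ∨ (rest c w).length < w.length ∧ 1 ≤ numBlocks w) := by
  obtain ⟨u, hu, h, hc⟩ := exists_inv hb hlow hup w hw
  have htotal := fun k => total_le hb hc h (k := k)
  have hdyck := fun k => dyckWithin_total hlow h (k := k) (v := [])
  have hnb := h.numBlocks_current
  have hk := h.length_kept_le
  have hmono := numBlocks_le_append u (scan c w).current
  have hb := h.blocks
  rw [← hu] at htotal hdyck hnb hmono
  simp only [List.append_nil] at hdyck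
  refine ⟨htotal, hdyck, ?_, ?_⟩
  · rw [rest, stack, List.reverse_append, numBlocks_append_opns]
    omega
  · have hlen := congrArg List.length hu
    by_cases hl : (scan c w).left = []
    · have hr : (scan c w).right = [] := by simpa [hl] using h.length_eq.symm
      simp only [rest, stack, List.reverse_append]
      simp only [current, hl, hr, window, List.map_nil, List.reverse_nil, List.append_nil] at hu
      rcases h.removed with e | ⟨e₁, e₂⟩
      · left
        rw [e, ← hu]
      · right
        refine ⟨?_, e₂.trans hmono⟩
        simp only [current, hl, hr, window, List.map_nil, List.reverse_nil, List.append_nil,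
          List.length_append, List.length_reverse, List.length_map] at hlen ⊢
        omega
    · right
      have := List.length_pos_of_ne_nil hl
      refine ⟨?_, by rw [hnb hl]; omega⟩
      simp only [current, window, rest, stack, List.length_append, List.length_reverse,
        List.length_map] at hlen ⊢
      omega

end Scan

/-! ### Total correctness of programs -/

section Halts

variable {O : List ℕ → List ℕ → ℕ} {α : ℕ → ℕ} {ω : ℕ → Bool} {S : State}
  {Q : State → ℕ → Prop}

/-- Started in state `S`, the program halts in a state and after a time that satisfy `Q`. -/
def Halts (O : List ℕ → List ℕ → ℕ) (α : ℕ → ℕ) (ω : ℕ → Bool) (p : Prog) (S : State)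
    (Q : State → ℕ → Prop) : Prop :=
  ∃ S' t, Exec O α ω p S S' t ∧ Q S' t

theorem Halts.mono {p : Prog} {R : State → ℕ → Prop} (h : Halts O α ω p S Q)
    (hQ : ∀ S' t, Q S' t → R S' t) : Halts O α ω p S R := by
  obtain ⟨S', t, h, q⟩ := h
  exact ⟨S', t, h, hQ _ _ q⟩

@[simp] theorem halts_skip : Halts O α ω .skip S Q ↔ Q S 1 :=
  ⟨fun ⟨_, _, h, q⟩ => by cases h; exact q, fun q => ⟨_, _, .skip S, q⟩⟩

@[simp] theorem halts_const {x k : ℕ} : Halts O α ω (.const x k) S Q ↔ Q (S.set x k) 1 :=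
  ⟨fun ⟨_, _, h, q⟩ => by cases h; exact q, fun q => ⟨_, _, .const S x k, q⟩⟩

@[simp] theorem halts_copy {x y : ℕ} : Halts O α ω (.copy x y) S Q ↔ Q (S.set x (S.reg y)) 1 :=
  ⟨fun ⟨_, _, h, q⟩ => by cases h; exact q, fun q => ⟨_, _, .copy S x y, q⟩⟩

@[simp] theorem halts_inc {x : ℕ} : Halts O α ω (.inc x) S Q ↔ Q (S.set x (S.reg x + 1)) 1 :=
  ⟨fun ⟨_, _, h, q⟩ => by cases h; exact q, fun q => ⟨_, _, .inc S x, q⟩⟩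

@[simp] theorem halts_dec {x : ℕ} : Halts O α ω (.dec x) S Q ↔ Q (S.set x (S.reg x - 1)) 1 :=
  ⟨fun ⟨_, _, h, q⟩ => by cases h; exact q, fun q => ⟨_, _, .dec S x, q⟩⟩

@[simp] theorem halts_load {x a i : ℕ} :
    Halts O α ω (.load x a i) S Q ↔ Q (S.set x (S.arr a (S.reg i))) 1 :=
  ⟨fun ⟨_, _, h, q⟩ => by cases h; exact q, fun q => ⟨_, _, .load S x a i, q⟩⟩

@[simp] theorem halts_store {x a i : ℕ} :
    Halts O α ω (.store a i x) S Q ↔ Q (S.setArr a (S.reg i) (S.reg x)) 1 :=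
  ⟨fun ⟨_, _, h, q⟩ => by cases h; exact q, fun q => ⟨_, _, .store S a i x, q⟩⟩

@[simp] theorem halts_call {x a l b m : ℕ} : Halts O α ω (.call x a l b m) S Q ↔
    Q (S.set x (O (S.slice a (S.reg l)) (S.slice b (S.reg m)))) (α (S.reg l + S.reg m) + 1) :=
  ⟨fun ⟨_, _, h, q⟩ => by cases h; exact q, fun q => ⟨_, _, .call S x a l b m, q⟩⟩

theorem halts_seq {p q : Prog} : Halts O α ω (.seq p q) S Q ↔
    Halts O α ω p S fun S₁ t₁ => Halts O α ω q S₁ fun S₂ t₂ => Q S₂ (t₁ + t₂) := by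
  constructor
  · rintro ⟨_, _, h, r⟩
    cases h with
    | seq h₁ h₂ => exact ⟨_, _, h₁, _, _, h₂, r⟩
  · rintro ⟨_, _, h₁, _, _, h₂, r⟩
    exact ⟨_, _, h₁.seq h₂, r⟩

@[simp] theorem halts_ifLt {x y : ℕ} {p q : Prog} : Halts O α ω (.ifLt x y p q) S Q ↔
    if S.reg x < S.reg y then Halts O α ω p S fun S' t => Q S' (t + 1)
    else Halts O α ω q S fun S' t => Q S' (t + 1) := by
  constructor
  · rintro ⟨_, _, h, r⟩
    cases h with
    | ifLt_true hc h => rw [if_pos hc]; exact ⟨_, _, h, r⟩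
    | ifLt_false hc h => rw [if_neg hc]; exact ⟨_, _, h, r⟩
  · intro h
    split at h
    · obtain ⟨_, _, h, r⟩ := h
      exact ⟨_, _, .ifLt_true ‹_› h, r⟩
    · obtain ⟨_, _, h, r⟩ := h
      exact ⟨_, _, .ifLt_false ‹_› h, r⟩

@[simp] theorem halts_ifEq {x y : ℕ} {p q : Prog} : Halts O α ω (.ifEq x y p q) S Q ↔
    if S.reg x = S.reg y then Halts O α ω p S fun S' t => Q S' (t + 1)
    else Halts O α ω q S fun S' t => Q S' (t + 1) := by
  constructor
  · rintro ⟨_, _, h, r⟩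
    cases h with
    | ifEq_true hc h => rw [if_pos hc]; exact ⟨_, _, h, r⟩
    | ifEq_false hc h => rw [if_neg hc]; exact ⟨_, _, h, r⟩
  · intro h
    split at h
    · obtain ⟨_, _, h, r⟩ := h
      exact ⟨_, _, .ifEq_true ‹_› h, r⟩
    · obtain ⟨_, _, h, r⟩ := h
      exact ⟨_, _, .ifEq_false ‹_› h, r⟩

/-- A loop with an invariant `I` on states and elapsed time and a measure `μ` that decreases. -/
theorem halts_whileLt {x y : ℕ} {p : Prog} (I : State → ℕ → Prop) (μ : State → ℕ) (h₀ : I S 0)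
    (hstep : ∀ S t, I S t → S.reg x < S.reg y →
      Halts O α ω p S fun S' t' => I S' (t + t' + 1) ∧ μ S' < μ S)
    (hdone : ∀ S t, I S t → ¬ S.reg x < S.reg y → Q S (t + 1)) :
    Halts O α ω (.whileLt x y p) S Q := by
  have key : ∀ m S t, μ S = m → I S t →
      Halts O α ω (.whileLt x y p) S fun S' t' => Q S' (t + t') := by
    intro m
    induction m using Nat.strong_induction_on with
    | _ m ih =>
      intro S t hm hI
      by_cases hc : S.reg x < S.reg y
      · obtain ⟨S₁, t₁, e₁, hI₁, hμ⟩ := hstep S t hI hc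
        obtain ⟨S₂, t₂, e₂, q⟩ := ih _ (hm ▸ hμ) S₁ _ rfl hI₁
        refine ⟨S₂, _, .while_step hc e₁ e₂, ?_⟩
        change Q S₂ (t + (t₁ + t₂ + 1))
        rwa [show t + (t₁ + t₂ + 1) = t + t₁ + 1 + t₂ by omega]
      · exact ⟨S, _, .while_done hc, hdone S t hI hc⟩
  simpa using key _ S 0 rfl h₀

/-- Run programs one after the other. -/
def block : List Prog → Prog
  | [] => .skip
  | p :: l => .seq p (block l)

@[simp] theorem halts_block_nil : Halts O α ω (block []) S Q ↔ Q S 1 := halts_skip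

@[simp] theorem halts_block_cons {p : Prog} {l : List Prog} : Halts O α ω (block (p :: l)) S Q ↔
    Halts O α ω p S fun S₁ t₁ => Halts O α ω (block l) S₁ fun S₂ t₂ => Q S₂ (t₁ + t₂) := halts_seq

@[simp] theorem State.reg_set (S : State) (x v y : ℕ) :
    (S.set x v).reg y = if y = x then v else S.reg y := by
  simp [State.set, Function.update_apply]

@[simp] theorem State.arr_set (S : State) (x v : ℕ) : (S.set x v).arr = S.arr := rfl

@[simp] theorem State.reg_setArr (S : State) (a i v : ℕ) : (S.setArr a i v).reg = S.reg := rfl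

@[simp] theorem State.arr_setArr (S : State) (a i v b : ℕ) :
    (S.setArr a i v).arr b = if b = a then Function.update (S.arr a) i v else S.arr b := by
  simp [State.setArr, Function.update_apply]

end Halts

/-! ### Strings of parentheses in memory -/

/-- The arrays `f` and `g` hold, from index `i` on, the kinds and the types of the symbols. -/
def Holds (f g : ℕ → ℕ) : ℕ → List (Paren s) → Prop
  | _, [] => True
  | i, x :: l => f i = x.kind ∧ g i = x.type ∧ Holds f g (i + 1) l

@[simp] theorem holds_nil (f g : ℕ → ℕ) (i : ℕ) : Holds f g i ([] : List (Paren s)) := by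
  simp [Holds]

@[simp] theorem holds_cons (f g : ℕ → ℕ) (i : ℕ) (x : Paren s) (l : List (Paren s)) :
    Holds f g i (x :: l) ↔ f i = x.kind ∧ g i = x.type ∧ Holds f g (i + 1) l := by
  simp [Holds]

theorem holds_append {f g : ℕ → ℕ} {i : ℕ} {u v : List (Paren s)} :
    Holds f g i (u ++ v) ↔ Holds f g i u ∧ Holds f g (i + u.length) v := by
  induction u generalizing i with
  | nil => simp
  | cons x u ih => simp [ih, and_assoc, Nat.add_assoc, Nat.add_comm 1]

theorem Holds.update {f g : ℕ → ℕ} {i : ℕ} {l : List (Paren s)} (h : Holds f g i l) {j a b : ℕ}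
    (hj : j < i ∨ i + l.length ≤ j) :
    Holds (Function.update f j a) (Function.update g j b) i l := by
  induction l generalizing i with
  | nil => simp
  | cons x l ih =>
    simp only [holds_cons, List.length_cons] at h hj ⊢
    have : i ≠ j := by omega
    exact ⟨by simp [this, h.1], by simp [this, h.2.1], ih h.2.2 (by omega)⟩

theorem Holds.push {f g : ℕ → ℕ} {i : ℕ} {st : List (Paren s)} (h : Holds f g i st.reverse)
    (x : Paren s) {j : ℕ} (hj : j = i + st.length) :
    Holds (Function.update f j x.kind) (Function.update g j x.type) i (x :: st).reverse := by
  subst hj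
  rw [List.reverse_cons, holds_append]
  exact ⟨h.update (by simp), by simp⟩

theorem holds_initState (σ : List (Paren s)) :
    Holds ((initState σ).arr 0) ((initState σ).arr 1) 0 σ := by
  have key : ∀ u v : List (Paren s), σ = u ++ v →
      Holds ((initState σ).arr 0) ((initState σ).arr 1) u.length v := by
    intro u v
    induction v generalizing u with
    | nil => simp
    | cons x v ih =>
      intro h
      refine (holds_cons _ _ _ _ _).2 ⟨?_, ?_, ?_⟩
      · simp [initState, h]
      · simp [initState, h]
      · simpa using ih (u ++ [x]) (by simpa using h)
  simpa using key [] σ rfl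

theorem Paren.type_eq_iff {a b : Fin s} : (Paren.opn a).type = (Paren.cls b).type ↔ a = b := by
  simp [Paren.type, Fin.ext_iff]

/-- The sentinel has kind `1`, which is below no kind, so an empty stack behaves like one with a
close parenthesis on top. The sentinel is why strings are stored from index 1 on. -/
theorem cancelStep_of_top {st : List (Paren s)} {x : Paren s} {K T : ℕ}
    (h : st = [] ∧ K = 1 ∨ ∃ y st', st = y :: st' ∧ K = y.kind ∧ T = y.type) :
    (K < x.kind ∧ T = x.type → ∃ y, st = y :: cancelStep st x) ∧
      (¬ (K < x.kind ∧ T = x.type) → cancelStep st x = x :: st) := by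
  rcases h with ⟨rfl, rfl⟩ | ⟨y, st, rfl, rfl, rfl⟩
  · cases x <;> simp [cancelStep, Paren.kind]
  · cases x with
    | opn a => simp [cancelStep, Paren.kind]
    | cls b =>
      cases y with
      | opn a =>
        simp only [Paren.type_eq_iff, cancelStep]
        simp +contextual [Paren.kind]
      | cls a => simp [cancelStep, Paren.kind]

/-! ### The program -/

/-- Push the symbol in registers `3` and `4` onto the stack in arrays `2` and `3`. -/
def pushProg : Prog := block [.inc 2, .store 2 2 3, .store 3 2 4]

/-- Process one symbol of the input in the removal of well-formed substrings. -/
def cancelBody : Prog :=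
  block [.load 3 0 1, .load 4 1 1, .load 5 2 2, .load 6 3 2,
    .ifLt 5 3 (.ifEq 6 4 (.dec 2) pushProg) pushProg, .inc 1]

/-- Remove all well-formed substrings. Entry `0` of array `2` is a sentinel. -/
def cancelProg : Prog := block [.const 3 1, .store 2 7 3, .whileLt 1 0 cancelBody]

/-- Add the cost of the current block, the strings in arrays `4` and `5`, to register `11`. -/
def chargeProg : Prog :=
  block [.call 12 4 10 5 10, .ifLt 10 12 (.copy 12 10) .skip, .const 13 0,
    .whileLt 13 12 (block [.inc 11, .inc 13])]

/-- Begin a new block if symbols of the current one have been removed. -/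
def flushProg : Prog := .ifLt 7 10 (block [chargeProg, .const 9 0, .const 10 0]) .skip

/-- Remove the top of the stack and the close parenthesis in register `4`. -/
def popProg : Prog := block [.load 6 3 2, .dec 2, .dec 9, .store 4 10 6, .store 5 10 4, .inc 10]

/-- Process one symbol in a phase. -/
def phaseBody : Prog :=
  block [.inc 1, .load 3 2 1, .load 4 3 1,
    .ifEq 3 7 (block [flushProg, pushProg, .inc 9])
      (.ifLt 7 9 popProg (block [flushProg, pushProg]))]

/-- A phase. -/
def phaseProg : Prog :=
  block [.copy 15 14, .const 1 0, .const 2 0, .const 9 0, .const 10 0, .whileLt 1 14 phaseBody,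
    chargeProg, .copy 14 2]

/-- The whole algorithm. -/
def dyckProg : Prog :=
  block [cancelProg, .copy 14 2, .copy 15 14, .inc 15, .whileLt 14 15 phaseProg, .const 1 0,
    .whileLt 1 14 (block [.inc 11, .inc 1]), .copy 0 11]

/-! ### Correctness of the parts -/

section Parts

variable {O : List ℕ → List ℕ → ℕ} {α : ℕ → ℕ} {ω : ℕ → Bool}

theorem halts_cancelProg (σ : List (Paren s)) :
    Halts O α ω cancelProg (initState σ) fun S t =>
      S.reg 2 = (cancel σ).length ∧ S.reg 7 = 0 ∧ S.reg 11 = 0 ∧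
      Holds (S.arr 2) (S.arr 3) 1 (cancel σ) ∧ t ≤ 20 * σ.length + 10 := by
  simp only [cancelProg, halts_block_cons, halts_block_nil, halts_const, halts_store]
  refine halts_whileLt (fun S t => ∃ u v, σ = u ++ v ∧ S.reg 0 = σ.length ∧
    S.reg 1 = u.length ∧ S.reg 2 = (u.foldl cancelStep []).length ∧ S.reg 7 = 0 ∧
    S.reg 11 = 0 ∧ S.arr 2 0 = 1 ∧ Holds (S.arr 0) (S.arr 1) u.length v ∧
    Holds (S.arr 2) (S.arr 3) 1 (u.foldl cancelStep []).reverse ∧ t ≤ 20 * u.length)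
    (fun S => S.reg 0 - S.reg 1) ?_ ?_ ?_
  · refine ⟨[], σ, rfl, ?_⟩
    have := holds_initState σ
    simp [State.reg_set, State.reg_setArr, State.arr_set, State.arr_setArr] at this ⊢
    simpa [initState] using this
  · rintro S t ⟨u, v, hσ, h0, h1, h2, h7, h11, hs, hin, hst, ht⟩ hlt
    cases v with
    | nil => simp [hσ] at h0; omega
    | cons x v =>
      obtain ⟨hk, hty, hin⟩ := (holds_cons _ _ _ _ _).1 hin
      have hlen : σ.length = u.length + v.length + 1 := by simp [hσ]; omega
      set st := u.foldl cancelStep [] with hdef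
      have hfold : (u ++ [x]).foldl cancelStep [] = cancelStep st x := by simp [hdef]
      have hpush := hst.push x (j := st.length + 1) (by omega)
      simp [cancelBody, pushProg, h1, h2, hk, hty]
      have hμ : S.reg 0 - (u.length + 1) < S.reg 0 - u.length := by omega
      have htop : st = [] ∧ S.arr 2 st.length = 1 ∨ ∃ y st', st = y :: st' ∧
          S.arr 2 st.length = y.kind ∧ S.arr 3 st.length = y.type := by
        cases hst' : st with
        | nil => exact .inl ⟨rfl, hs⟩
        | cons y st' =>
          right
          rw [hst', List.reverse_cons, holds_append] at hst
          refine ⟨y, st', rfl, ?_⟩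
          simpa [Nat.add_comm] using hst.2
      have hcancel := cancelStep_of_top htop (x := x)
      split_ifs with hc₁ hc₂
      · obtain ⟨y, hy⟩ := hcancel.1 ⟨hc₁, hc₂⟩
        have hl := congrArg List.length hy
        refine ⟨⟨u ++ [x], v, by simp [hσ], h0, by simp, ?_, h7, h11, hs, by simpa using hin, ?_,
          by simp; omega⟩, hμ⟩
        · rw [hfold]
          simp only [List.length_cons] at hl
          omega
        · rw [hfold]
          rw [hy, List.reverse_cons, holds_append] at hst
          exact hst.1
      · have hy := hcancel.2 (by tauto)
        refine ⟨⟨u ++ [x], v, by simp [hσ], h0, by simp, ?_, h7, h11, hs, by simpa using hin, ?_,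
          by simp; omega⟩, hμ⟩
        · rw [hfold, hy]; simp
        · rw [hfold, hy]; exact hpush
      · have hy := hcancel.2 (by tauto)
        refine ⟨⟨u ++ [x], v, by simp [hσ], h0, by simp, ?_, h7, h11, hs, by simpa using hin, ?_,
          by simp; omega⟩, hμ⟩
        · rw [hfold, hy]; simp
        · rw [hfold, hy]; exact hpush
  · rintro S t ⟨u, v, hσ, h0, h1, h2, h7, h11, hs, hin, hst, ht⟩ hlt
    have hlen : σ.length = u.length + v.length := by simp [hσ]
    obtain rfl : v = [] := List.eq_nil_of_length_eq_zero (by omega)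
    obtain rfl : σ = u := by simpa using hσ
    exact ⟨by simpa [cancel] using h2, h7, h11, hst, by omega⟩

@[simp] theorem map_range_update (f : ℕ → ℕ) (l v : ℕ) :
    (List.range l).map (Function.update f l v) = (List.range l).map f := by
  simp only [List.map_inj_left, List.mem_range]
  intro i hi
  simp [hi.ne]

theorem halts_chargeProg (S : State) :
    Halts O α ω chargeProg S fun S' t =>
      S'.arr = S.arr ∧ (∀ x, x ≠ 11 → x ≠ 12 → x ≠ 13 → S'.reg x = S.reg x) ∧
      S'.reg 11 = S.reg 11 + min (O (S.slice 4 (S.reg 10)) (S.slice 5 (S.reg 10))) (S.reg 10) ∧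
      t ≤ α (S.reg 10 + S.reg 10) + 5 * S.reg 10 + 12 := by
  -- The charge is added in unit steps; truncating it at the number of pairs keeps this loop linear
  -- in the block.
  have loop : ∀ S : State, S.reg 13 = 0 →
      Halts O α ω (.whileLt 13 12 (block [.inc 11, .inc 13])) S fun S' t =>
        S'.arr = S.arr ∧ (∀ x, x ≠ 11 → x ≠ 12 → x ≠ 13 → S'.reg x = S.reg x) ∧
        S'.reg 11 = S.reg 11 + S.reg 12 ∧ t ≤ 5 * S.reg 12 + 1 := by
    intro S h
    refine halts_whileLt (fun S' t => S'.arr = S.arr ∧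
      (∀ x, x ≠ 11 → x ≠ 12 → x ≠ 13 → S'.reg x = S.reg x) ∧ S'.reg 12 = S.reg 12 ∧
      S'.reg 13 ≤ S.reg 12 ∧ S'.reg 11 = S.reg 11 + S'.reg 13 ∧ t ≤ 5 * S'.reg 13)
      (fun S' => S'.reg 12 - S'.reg 13) ?_ ?_ ?_
    · simp [h]
    · rintro S' t ⟨h1, h2, h3, h4, h5, h6⟩ hlt
      simp
      refine ⟨⟨h1, ?_, h3, by omega, by omega, by omega⟩, by omega⟩
      intro x hx₁ hx₂ hx₃
      simp [hx₁, hx₃, h2 x hx₁ hx₂ hx₃]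
    · rintro S' t ⟨h1, h2, h3, h4, h5, h6⟩ hlt
      exact ⟨h1, h2, by omega, by omega⟩
  simp only [chargeProg, halts_block_cons, halts_block_nil, halts_call, halts_ifLt, halts_copy,
    halts_skip, halts_const]
  split_ifs with hc
  all_goals
    refine (loop _ (by simp)).mono ?_
    rintro S' t ⟨h1, h2, h3, h4⟩
    simp at h1 h3 h4 hc
    refine ⟨h1, ?_, ?_, by omega⟩
    · intro x hx₁ hx₂ hx₃
      simp [hx₂, hx₃, h2 x hx₁ hx₂ hx₃]
    · omega

/-- The cost of a block: the answer of the subroutine, but not more than the number of pairs. -/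
def blockCost (O : List ℕ → List ℕ → ℕ) (A B : List (Fin s)) : ℕ :=
  min (O (A.map Fin.val) (B.map Fin.val)) A.length

/-- The machine is in the state `T` of a phase that began with cost `q`. -/
structure Represents (q : ℕ) (S : State) (T : Scan s) : Prop where
  zero : S.reg 7 = 0
  size : S.reg 2 = T.stack.length
  opens : S.reg 9 = T.opens.length
  length : S.reg 10 = T.left.length
  cost : S.reg 11 = q + T.cost
  stack : Holds (S.arr 2) (S.arr 3) 1 T.stack.reverse
  left : (List.range (S.reg 10)).map (S.arr 4) = T.left.map Fin.val
  right : (List.range (S.reg 10)).map (S.arr 5) = T.right.map Fin.val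

/-- `m` is the total length of the strings passed to the subroutine, zero if there is no call. -/
theorem halts_flushProg {q : ℕ} {S : State} {T : Scan s} (h : Represents q S T) :
    Halts O α ω flushProg S fun S' t =>
      Represents q S' (T.flush (blockCost O)) ∧ S'.arr = S.arr ∧
      (∀ x, x < 9 ∨ 13 < x → S'.reg x = S.reg x) ∧
      ∃ m, 2 * (T.flush (blockCost O)).left.length + m = 2 * T.left.length ∧
        t ≤ α m + 3 * m + 20 := by
  have h10 := h.length
  have h7 := h.zero
  by_cases hl : T.left = []
  · have : Scan.flush (blockCost O) T = T := by simp [Scan.flush, hl]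
    rw [this]
    simp only [hl, List.length_nil] at h10
    simp [flushProg, h7, h10]
    exact h
  · have hpos := List.length_pos_of_ne_nil hl
    simp [flushProg, h7]
    rw [if_pos (by omega)]
    refine (halts_chargeProg S).mono ?_
    rintro S' t ⟨h1, h2, h3, h4⟩
    have hf : Scan.flush (blockCost O) T = ⟨T.stack, [], [], [], T.total (blockCost O)⟩ := by
      simp [Scan.flush, hl]
    rw [hf]
    have h10' : min (O (T.left.map Fin.val) (T.right.map Fin.val)) (S.reg 10) =
        min (O (T.left.map Fin.val) (T.right.map Fin.val)) T.left.length := by rw [h10]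
    refine ⟨⟨?_, ?_, ?_, ?_, ?_, ?_, ?_, ?_⟩, h1, ?_, 2 * T.left.length, by simp, ?_⟩
    · simp [h2, h7]
    · simp [h2, h.size, Scan.stack]
    · simp
    · simp
    · simp [h3, h.cost, Scan.total, blockCost, State.slice, h.left, h.right, Nat.add_assoc, h10']
    · simpa [h1, Scan.stack] using h.stack
    · simp
    · simp
    · intro x hx
      have e1 : x ≠ 9 := by omega
      have e2 : x ≠ 10 := by omega
      simp [e1, e2, h2 x (by omega) (by omega) (by omega)]
    · rw [h10, ← two_mul] at h4
      omega

/-- The new stack overwrites the arrays that still hold the unread input; `hle` keeps the writes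
behind the reading position. The balance with `m` says that every symbol read is on the stack,
pending in the current block, or already passed to the subroutine. -/
theorem halts_phaseBody {q : ℕ} {S : State} {T : Scan s} (h : Represents q S T) {i : ℕ}
    (hi : S.reg 1 = i) (hle : T.stack.length ≤ i) {x : Paren s} {v : List (Paren s)}
    (hv : Holds (S.arr 2) (S.arr 3) (i + 1) (x :: v)) :
    Halts O α ω phaseBody S fun S' t =>
      Represents q S' (T.step (blockCost O) x) ∧ S'.reg 1 = i + 1 ∧ S'.reg 14 = S.reg 14 ∧
      S'.reg 15 = S.reg 15 ∧ Holds (S'.arr 2) (S'.arr 3) (i + 2) v ∧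
      ∃ m, 2 * (T.step (blockCost O) x).left.length + (T.step (blockCost O) x).stack.length + m =
        2 * T.left.length + T.stack.length + 1 ∧ t ≤ α m + 3 * m + 50 := by
  obtain ⟨hk, hty, hv'⟩ := (holds_cons _ _ _ _ _).1 hv
  have hstart : Represents q (((S.set 1 (i + 1)).set 3 x.kind).set 4 x.type) T := by
    obtain ⟨h1, h2, h3, h4, h5, h6, h7, h8⟩ := h
    exact ⟨by simpa using h1, by simpa using h2, by simpa using h3, by simpa using h4,
      by simpa using h5, by simpa using h6, by simpa using h7, by simpa using h8⟩
  have h7 := h.zero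
  have h9 := h.opens
  simp [phaseBody, pushProg, hi, hk, hty, h7, h9]
  cases x with
  | opn a =>
    rw [if_pos (by simp [Paren.kind])]
    refine (halts_flushProg hstart).mono ?_
    rintro S' t ⟨hrep, harr, hreg, m, hm, ht⟩
    have e1 := hreg 1 (by omega)
    have e3 := hreg 3 (by omega)
    have e4 := hreg 4 (by omega)
    have e14 := hreg 14 (by omega)
    have e15 := hreg 15 (by omega)
    simp at harr e1 e3 e4 e14 e15
    have e2 := hrep.size
    have hp := hrep.stack.push (.opn a) (j := T.stack.length + 1) (by
      rw [Scan.stack_flush]; omega)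
    rw [Scan.stack_flush] at e2 hp
    rw [← Scan.stack_step_opn (c := blockCost O)] at hp
    refine ⟨⟨?_, ?_, ?_, ?_, ?_, ?_, ?_, ?_⟩, by simpa using e1, by simpa using e14,
      by simpa using e15, ?_, m, ?_, by omega⟩
    · simp [hrep.zero]
    · simp [e2, Scan.stack_step_opn]
    · simp [hrep.opens, Scan.step]
    · simp [hrep.length, Scan.step]
    · simp [hrep.cost, Scan.step]
    · simpa [e2, e3, e4] using hp
    · simpa [Scan.step] using hrep.left
    · simpa [Scan.step] using hrep.right
    · rw [harr]
      exact hv'.update (by omega)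
    · rw [Scan.stack_step_opn]
      simp [Scan.step]
      omega
  | cls b =>
    rw [if_neg (by simp [Paren.kind])]
    cases hY : T.opens with
    | nil =>
      simp
      refine (halts_flushProg hstart).mono ?_
      rintro S' t ⟨hrep, harr, hreg, m, hm, ht⟩
      have e1 := hreg 1 (by omega)
      have e3 := hreg 3 (by omega)
      have e4 := hreg 4 (by omega)
      have e14 := hreg 14 (by omega)
      have e15 := hreg 15 (by omega)
      simp at harr e1 e3 e4 e14 e15
      have e2 := hrep.size
      have hp := hrep.stack.push (.cls b) (j := T.stack.length + 1) (by
        rw [Scan.stack_flush]; omega)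
      rw [Scan.stack_flush] at e2 hp
      rw [← Scan.stack_step_cls (c := blockCost O) hY] at hp
      refine ⟨⟨?_, ?_, ?_, ?_, ?_, ?_, ?_, ?_⟩, by simpa using e1, by simpa using e14,
        by simpa using e15, ?_, m, ?_, by omega⟩
      · simp [hrep.zero]
      · simp [e2, Scan.stack_step_cls hY]
      · simp [hrep.opens, Scan.step, hY]
      · simp [hrep.length, Scan.step, hY]
      · simp [hrep.cost, Scan.step, hY]
      · simpa [e2, e3, e4] using hp
      · simpa [Scan.step, hY] using hrep.left
      · simpa [Scan.step, hY] using hrep.right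
      · rw [harr]
        exact hv'.update (by omega)
      · rw [Scan.stack_step_cls hY]
        simp [Scan.step, hY]
        omega
    | cons a Y =>
      have hst : T.stack = .opn a :: (Y.map Paren.opn ++ T.kept) := by simp [Scan.stack, hY]
      have hst' : (T.step (blockCost O) (.cls b)).stack = Y.map Paren.opn ++ T.kept := by
        simp [Scan.step, Scan.stack, hY]
      have hs := h.stack
      rw [hst, List.reverse_cons, holds_append] at hs
      have hsize := h.size
      have htop : S.arr 3 (S.reg 2) = a := by
        have := ((holds_cons _ _ _ _ _).1 hs.2).2.1
        rw [hsize, hst]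
        simpa [Nat.add_comm, Paren.type] using this
      simp [popProg, htop]
      refine ⟨⟨?_, ?_, ?_, ?_, ?_, ?_, ?_, ?_⟩, hv', 0, ?_⟩
      · simpa using h7
      · simp [hst', hsize, hst]
      · simp [h9, Scan.step, hY]
      · simp [h.length, Scan.step, hY]
      · simp [h.cost, Scan.step, hY]
      · simpa [hst'] using hs.1
      · simp [List.range_succ, h.left, Scan.step, hY]
      · simp [List.range_succ, h.right, Scan.step, hY, Paren.type]
      · rw [hst', hst]
        simp [Scan.step, hY]
        omega

/-- `m` is the number of removed symbols and also the total length of the calls, which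
superadditivity merges into `α m`. -/
theorem halts_phaseProg {S : State} {w : List (Paren s)} (h7 : S.reg 7 = 0)
    (h14 : S.reg 14 = w.length) (hw : Holds (S.arr 2) (S.arr 3) 1 w)
    (hα : ∀ a b : ℕ, α a + α b ≤ α (a + b)) :
    Halts O α ω phaseProg S fun S' t =>
      S'.reg 7 = 0 ∧ S'.reg 14 = (Scan.rest (blockCost O) w).length ∧ S'.reg 15 = w.length ∧
      Holds (S'.arr 2) (S'.arr 3) 1 (Scan.rest (blockCost O) w) ∧
      S'.reg 11 = S.reg 11 + Scan.charge (blockCost O) w ∧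
      ∃ m, (Scan.rest (blockCost O) w).length + m = w.length ∧
        t ≤ 60 * w.length + α m + 3 * m + 30 := by
  simp only [phaseProg, halts_block_cons, halts_block_nil, halts_copy, halts_const]
  refine halts_whileLt (fun S' t => ∃ u v, w = u ++ v ∧
    Represents (S.reg 11) S' (Scan.scan (blockCost O) u) ∧ S'.reg 1 = u.length ∧
    S'.reg 14 = w.length ∧ S'.reg 15 = w.length ∧
    Holds (S'.arr 2) (S'.arr 3) (u.length + 1) v ∧
    ∃ m, 2 * (Scan.scan (blockCost O) u).left.length +
      (Scan.scan (blockCost O) u).stack.length + m = u.length ∧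
      t ≤ 60 * u.length + α m + 3 * m) (fun S => S.reg 14 - S.reg 1) ?_ ?_ ?_
  · refine ⟨[], w, rfl, ⟨?_, ?_, ?_, ?_, ?_, ?_, ?_, ?_⟩, ?_, ?_, ?_, ?_, 0, ?_, ?_⟩ <;>
      simp [Scan.scan, Scan.start, Scan.stack, h7, h14, hw]
  · rintro S' t ⟨u, v, hu, hrep, h1, h14, h15, hv, m, hm, ht⟩ hlt
    cases v with
    | nil => simp [hu] at h14; omega
    | cons x v =>
      refine (halts_phaseBody hrep h1 (by omega) hv).mono ?_
      rintro S₁ t₁ ⟨hrep', e1, e14, e15, hv', m', hm', ht'⟩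
      have := hα m m'
      refine ⟨⟨u ++ [x], v, by simp [hu], ?_, by simp [e1], by omega, by omega, ?_, m + m', ?_, ?_⟩,
        by omega⟩
      · rw [Scan.scan_append_singleton]; exact hrep'
      · simpa using hv'
      · rw [Scan.scan_append_singleton]; simp; omega
      · simp; omega
  · rintro S' t ⟨u, v, hu, hrep, h1, h14, h15, hv, m, hm, ht⟩ hlt
    have hlen : w.length = u.length + v.length := by simp [hu]
    obtain rfl : v = [] := List.eq_nil_of_length_eq_zero (by omega)
    obtain rfl : w = u := by simpa using hu
    refine (halts_chargeProg S').mono ?_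
    rintro S₁ t₁ ⟨g1, g2, g3, g4⟩
    have hl := hrep.length
    have hc : S₁.reg 11 = S.reg 11 + Scan.charge (blockCost O) w := by
      rw [g3, State.slice, State.slice, hrep.left, hrep.right, hrep.cost, hl]
      simp [Scan.charge, Scan.total, blockCost, Nat.add_assoc]
    have e2 : S₁.reg 2 = (Scan.rest (blockCost O) w).length := by
      rw [g2 2 (by omega) (by omega) (by omega), hrep.size]
      simp [Scan.rest]
    have e7 : S₁.reg 7 = 0 := by rw [g2 7 (by omega) (by omega) (by omega), hrep.zero]
    have e15 : S₁.reg 15 = w.length := by rw [g2 15 (by omega) (by omega) (by omega), h15]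
    have e := hα m (S'.reg 10 + S'.reg 10)
    simp [hc, e2, e7, e15, g1]
    refine ⟨hrep.stack, m + (S'.reg 10 + S'.reg 10), ?_, ?_⟩
    · simp only [Scan.rest, List.length_reverse]
      omega
    · omega

end Parts
variable {O : List ℕ → List ℕ → ℕ} {α : ℕ → ℕ} {β : ℕ → ℝ} {ω : ℕ → Bool}

/-! ### The whole algorithm -/

/-- Truncation is harmless, since strings of equal length can be aligned by substitutions alone. -/
theorem exists_edits_le_blockCost (hO : ApproxStrEdit s β O) (A B : List (Fin s))
    (h : A.length = B.length) : ∃ j ≤ blockCost O A B, Edits A B j := by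
  rcases le_total (O (A.map Fin.val) (B.map Fin.val)) A.length with hl | hl
  · refine ⟨strEdit (A.map Fin.val) (B.map Fin.val), ?_,
      (edits_strEdit _ _).of_map Fin.val_injective rfl rfl⟩
    rw [blockCost, min_eq_left hl]
    exact (hO _ _ (by simp) (by simp)).1
  · exact ⟨A.length, by rw [blockCost, min_eq_right hl], Edits.of_length_eq h⟩

/-- The maximum with `0` covers the empty input, as `β 0` may be negative. -/
theorem blockCost_le (hO : ApproxStrEdit s β O) (hβ : Monotone β) {n : ℕ} (A B : List (Fin s))
    (h : A.length + B.length ≤ n) :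
    (blockCost O A B : ℝ) ≤ max (β n) 0 * strEdit (A.map Fin.val) (B.map Fin.val) := by
  have h1 := (hO (A.map Fin.val) (B.map Fin.val) (by simp) (by simp)).2
  simp only [List.length_map] at h1
  calc (blockCost O A B : ℝ) ≤ O (A.map Fin.val) (B.map Fin.val) := by
        exact_mod_cast min_le_left _ _
    _ ≤ β (A.length + B.length) * strEdit (A.map Fin.val) (B.map Fin.val) := h1
    _ ≤ _ := by
        gcongr
        exact (hβ h).trans (le_max_left _ _)

/-- Tested on a single letter and the empty string, whose distance is 1. -/
theorem one_le_of_approxStrEdit (hs : 0 < s) (hO : ApproxStrEdit s β O) (hβ : Monotone β) {n : ℕ}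
    (hn : 1 ≤ n) : 1 ≤ β n := by
  have h := hO [0] [] (by simpa using hs) (by simp)
  have h1 : 1 ≤ strEdit [0] ([] : List ℕ) := by
    by_contra hc
    have := edits_strEdit [0] ([] : List ℕ)
    rw [show strEdit [0] ([] : List ℕ) = 0 by omega] at this
    cases this
  have h2 : strEdit [0] ([] : List ℕ) ≤ 1 := strEdit_le (edits_nil_right [0])
  have h3 : strEdit [0] ([] : List ℕ) = 1 := le_antisymm h2 h1
  have h4 : ((1 : ℕ) : ℝ) ≤ O [0] [] := by exact_mod_cast h1.trans h.1
  have h5 := h.2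
  rw [h3] at h5
  have := hβ hn
  rw [Nat.cast_one] at h4
  simp at h5
  linarith

theorem numBlocks_le_length (w : List (Paren s)) : numBlocks w ≤ w.length := by
  refine List.countP_le_length.trans ?_
  simp

theorem halts_dyckProg (hα : ∀ a b : ℕ, α a + α b ≤ α (a + b)) (hβ : Monotone β)
    (hO : ApproxStrEdit s β O) (σ : List (Paren s)) :
    Halts O α ω dyckProg (initState σ) fun S t =>
      dyckDist σ ≤ S.reg 0 ∧
      (S.reg 0 : ℝ) ≤ (Nat.log 2 (numBlocks (cancel σ)) + 2 : ℕ) *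
        (2 * max (β σ.length) 0 * (2 * dyckDist σ : ℕ)) + (2 * dyckDist σ : ℕ) ∧
      t ≤ (Nat.log 2 (numBlocks (cancel σ)) + 2) * (60 * σ.length + 40) + α σ.length +
        30 * σ.length + 40 := by
  set z := numBlocks (cancel σ) with hz
  set D := 2 * dyckDist σ with hD
  set b := max (β σ.length) 0 with hb
  set n := σ.length with hn
  have hb0 : 0 ≤ b := le_max_right _ _
  have hlow := exists_edits_le_blockCost hO
  have hup := fun A B => blockCost_le hO hβ (n := n) A B
  have hαmono : ∀ m, m ≤ n → α m ≤ α n := by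
    intro m hm
    have := hα m (n - m)
    rw [Nat.add_sub_cancel' hm] at this
    omega
  have hcancel : (cancel σ).length ≤ n := by
    have := length_foldl_cancelStep_le σ []
    simpa [cancel] using this
  have hdel : DeletesWithin D (cancel σ) := (dyckWithin_dyckDist σ).deletesWithin.cancel
  simp only [dyckProg, halts_block_cons, halts_block_nil, halts_copy, halts_const, halts_inc]
  refine (halts_cancelProg σ).mono ?_
  rintro S₀ t₀ ⟨h2, h7, h11, hst, ht₀⟩
  -- `i` counts phases. A phase that shortens the string starts with a block, so `2 ^ i ≤ z` before
  -- it; there are at most `Nat.log 2 z + 1` of these, and one more phase finds nothing to remove.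
  -- `m` covers the symbols removed in all phases.
  refine halts_whileLt (fun S t => ∃ (i : ℕ) (w : List (Paren s)), S.reg 7 = 0 ∧ S.reg 14 = w.length ∧
    Holds (S.arr 2) (S.arr 3) 1 w ∧ DeletesWithin D w ∧
    (S.reg 11 : ℝ) ≤ i * (2 * b * D) ∧ (∀ k, DyckWithin k w → DyckWithin (k + S.reg 11) σ) ∧
    i ≤ Nat.log 2 z + 2 ∧ 2 ^ i * numBlocks w ≤ z ∧
    (S.reg 14 < S.reg 15 → i ≤ Nat.log 2 z + 1) ∧
    (¬ S.reg 14 < S.reg 15 → numBlocks w = 0) ∧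
    ∃ m, w.length + m ≤ n ∧ t ≤ i * (60 * n + 40) + α m + 3 * m)
    (fun S => S.reg 15) ?_ ?_ ?_
  -- Register `15` starts one above register `14`, so the first phase always runs and the condition
  -- for leaving the loop is vacuous here.
  · refine ⟨0, cancel σ, ?_⟩
    simp [h2, h7, h11, hst, hdel, ← hz]
    exact ⟨fun k hk => hk.of_cancel, 0, by simpa using hcancel⟩
  · rintro S t ⟨i, w, g7, g14, gw, gdel, gcost, glow, gi, gnb, glt, -, m, gm, gt⟩ hlt
    have hphase := Scan.phase_spec (c := blockCost O) hb0 hlow hup (w := w) (by omega)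
    obtain ⟨p1, p2, p3, p4⟩ := hphase
    have p1 := p1 D gdel.factorWithin
    refine (halts_phaseProg g7 g14 gw hα).mono ?_
    rintro S' t' ⟨e7, e14, e15, ew, e11, m', em, et⟩
    have hi := glt hlt
    have hnb : 2 ^ (i + 1) * numBlocks (Scan.rest (blockCost O) w) ≤ z := by
      calc _ = 2 ^ i * (2 * numBlocks (Scan.rest (blockCost O) w)) := by ring
        _ ≤ 2 ^ i * numBlocks w := Nat.mul_le_mul_left _ p3
        _ ≤ z := gnb
    refine ⟨⟨i + 1, Scan.rest (blockCost O) w, e7, e14, ew, Scan.deletesWithin_rest _ gdel, ?_, ?_,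
      by omega, hnb, ?_, ?_, m + m', by omega, ?_⟩, by omega⟩
    · rw [e11]
      push_cast
      linarith
    · intro k hk
      have := glow _ (p2 k hk)
      rwa [e11, show k + (S.reg 11 + Scan.charge (blockCost O) w) =
        k + Scan.charge (blockCost O) w + S.reg 11 by omega]
    · intro hc
      rcases p4 with p4 | ⟨-, p4⟩
      · rw [p4] at e14
        omega
      · have hzi : 2 ^ i ≤ z := (Nat.le_mul_of_pos_right _ p4).trans gnb
        have hz0 : z ≠ 0 := by
          have : 0 < 2 ^ i := by positivity
          omega
        have := (Nat.le_log_iff_pow_le (b := 2) (by norm_num) hz0).2 hzi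
        omega
    · intro hc
      rcases p4 with p4 | ⟨p4, -⟩
      -- The number of blocks is unchanged and yet at most half of itself, so it is zero.
      · rw [p4] at p3 ⊢
        omega
      · omega
    · have := hα m m'
      have hwn : w.length ≤ n := by omega
      have : (i + 1) * (60 * n + 40) = i * (60 * n + 40) + (60 * n + 40) := by ring
      omega
  · rintro S t ⟨i, w, g7, g14, gw, gdel, gcost, glow, gi, gnb, -, gdone, m, gm, gt⟩ hlt
    -- The leftover has no block, so deleting all of it costs at most `D`.
    have hlen := gdel.length_le (gdone hlt)
    have hdist := (glow _ (dyckWithin_length w)).dyckDist_le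
    have hαm := hαmono m (by omega)
    have hi' : i * (60 * n + 40) ≤ (Nat.log 2 z + 2) * (60 * n + 40) := Nat.mul_le_mul_right _ gi
    refine halts_whileLt (fun S' t => S'.reg 14 = w.length ∧ S'.reg 1 ≤ w.length ∧
      S'.reg 11 = S.reg 11 + S'.reg 1 ∧ t ≤ 5 * S'.reg 1) (fun S => S.reg 14 - S.reg 1) ?_ ?_ ?_
    · simp [g14]
    · rintro S' t' ⟨f14, f1, f11, ft⟩ hlt'
      simp
      omega
    · rintro S' t' ⟨f14, f1, f11, ft⟩ hlt'
      have e11 : S'.reg 11 = S.reg 11 + w.length := by omega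
      simp only [State.reg_set, if_true]
      refine ⟨by omega, ?_, by omega⟩
      rw [e11]
      push_cast
      have c1 : (w.length : ℝ) ≤ D := by exact_mod_cast hlen
      have c2 : (i : ℝ) * (2 * b * D) ≤ (Nat.log 2 z + 2) * (2 * b * D) := by
        gcongr
        exact_mod_cast gi
      linarith

/-! ### Logarithm estimates and the final bounds -/

theorem natLog_two_le (m : ℕ) : (Nat.log 2 m : ℝ) ≤ 2 * Real.log m := by
  rcases Nat.eq_zero_or_pos m with rfl | hm
  · simp
  · have h : ((2 : ℕ) ^ Nat.log 2 m : ℝ) ≤ m := by exact_mod_cast Nat.pow_log_le_self 2 hm.ne'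
    have h1 := Real.log_le_log (by positivity) h
    rw [Real.log_pow] at h1
    have := Real.log_two_gt_d9
    have h0 : (0 : ℝ) ≤ Nat.log 2 m := by positivity
    push_cast at h1
    nlinarith

/-- The summand 1 is needed at `n = 1`, where the logarithm vanishes. -/
theorem natCast_le_mul_log (n : ℕ) : (n : ℝ) ≤ 2 * (n * Real.log n) + 1 := by
  rcases Nat.lt_or_ge n 2 with h | h
  · interval_cases n <;> simp
  · have h2 : (2 : ℝ) ≤ n := by exact_mod_cast h
    have h1 := Real.log_le_log (by norm_num) h2
    have := Real.log_two_gt_d9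
    nlinarith

theorem log_natCast_le_mul_log (n : ℕ) : Real.log n ≤ n * Real.log n := by
  rcases Nat.eq_zero_or_pos n with rfl | hn
  · simp
  · have h1 : (1 : ℝ) ≤ n := by exact_mod_cast hn
    nlinarith [Real.log_nonneg h1]

theorem dyckDist_le_length (σ : List (Paren s)) : dyckDist σ ≤ σ.length :=
  (dyckWithin_length σ).dyckDist_le

theorem exists_outputs_dyckProg (hs : 0 < s) (hα : ∀ a b : ℕ, α a + α b ≤ α (a + b))
    (hβ : Monotone β) (hO : ApproxStrEdit s β O) (σ : List (Paren s)) (ω : ℕ → Bool) :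
    ∃ v t : ℕ, Outputs O α dyckProg σ ω v t ∧
      (t : ℝ) ≤ 1000 * (σ.length * Real.log σ.length + α σ.length + 1) ∧ dyckDist σ ≤ v ∧
      (dyckDist σ = 0 → v = 0) ∧
      (2 ≤ dyckDist σ → (v : ℝ) ≤ 1000 * (β σ.length *
        (1 + Real.log (numBlocks (cancel σ))) * √(Real.log (dyckDist σ))) * dyckDist σ) := by
  obtain ⟨S, t, hexec, h1, h2, h3⟩ := halts_dyckProg (ω := ω) hα hβ hO σ
  refine ⟨S.reg 0, t, ⟨S, hexec, rfl⟩, ?_, h1, ?_, ?_⟩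
  · have hz : numBlocks (cancel σ) ≤ σ.length := by
      refine (numBlocks_le_length _).trans ?_
      have := length_foldl_cancelStep_le σ []
      simpa [cancel] using this
    have hlog : (Nat.log 2 (numBlocks (cancel σ)) : ℝ) ≤ 2 * Real.log σ.length :=
      le_trans (by exact_mod_cast Nat.log_mono_right hz) (natLog_two_le _)
    have e1 := natCast_le_mul_log σ.length
    have e2 := log_natCast_le_mul_log σ.length
    have h3' : (t : ℝ) ≤ (Nat.log 2 (numBlocks (cancel σ)) + 2) * (60 * σ.length + 40) +
        α σ.length + 30 * σ.length + 40 := by exact_mod_cast h3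
    have e3 : ((Nat.log 2 (numBlocks (cancel σ)) : ℝ) + 2) * (60 * σ.length + 40) ≤
        (2 * Real.log σ.length + 2) * (60 * σ.length + 40) := by gcongr
    have e4 : (0 : ℝ) ≤ α σ.length := by positivity
    have e5 : (0 : ℝ) ≤ σ.length * Real.log σ.length := by
      have := Real.log_natCast_nonneg σ.length
      positivity
    nlinarith
  · intro hd
    rw [hd] at h2
    have : (S.reg 0 : ℝ) ≤ 0 := by simpa using h2
    exact Nat.le_zero.1 (by exact_mod_cast this)
  · intro hd
    have hn : 1 ≤ σ.length := by have := dyckDist_le_length σ; omega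
    have hb := one_le_of_approxStrEdit hs hO hβ hn
    rw [max_eq_left (by linarith)] at h2
    set b := β σ.length
    set z := numBlocks (cancel σ)
    have hL := natLog_two_le z
    have hz := Real.log_natCast_nonneg z
    have hd' : (2 : ℝ) ≤ dyckDist σ := by exact_mod_cast hd
    -- This is where `2 ≤ d` enters: log 2 exceeds 1/4.
    have hr : (1 / 2 : ℝ) ≤ √(Real.log (dyckDist σ)) := by
      refine Real.le_sqrt_of_sq_le ?_
      have h1 := Real.log_le_log (by norm_num) hd'
      have := Real.log_two_gt_d9
      linarith
    push_cast at h2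
    calc (S.reg 0 : ℝ) ≤ (Nat.log 2 z + 2) * (2 * b * (2 * dyckDist σ)) + 2 * dyckDist σ := h2
      -- The final deletions are absorbed using `1 ≤ b`.
      _ ≤ (2 * Real.log z + 2) * (2 * b * (2 * dyckDist σ)) + b * (2 * dyckDist σ) := by
          refine add_le_add (mul_le_mul_of_nonneg_right (by linarith) (by positivity)) ?_
          nlinarith
      _ = (b * (8 * Real.log z + 10)) * dyckDist σ := by ring
      _ ≤ (1000 * (b * (1 + Real.log z) * (1 / 2))) * dyckDist σ := by
          refine mul_le_mul_of_nonneg_right ?_ (by positivity)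
          nlinarith [mul_nonneg (zero_le_one.trans hb) hz]
      _ ≤ _ := by gcongr

end DyckEdit

theorem theorem3 :
    ∃ (p : Prog) (C : ℝ), 0 < C ∧
      ∀ (s : ℕ), 2 ≤ s →
      ∀ (α : ℕ → ℕ) (β : ℕ → ℝ) (O : List ℕ → List ℕ → ℕ),
        (∀ a b : ℕ, α a + α b ≤ α (a + b)) → Monotone β → ApproxStrEdit s β O →
      ∀ (σ : List (Paren s)) (n d z : ℕ),
        n = σ.length → d = dyckDist σ → z = numBlocks (cancel σ) →
        (∀ ω : ℕ → Bool, ∃ v t : ℕ, Outputs O α p σ ω v t ∧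
          (t : ℝ) ≤ C * (n * Real.log n + α n + 1) ∧ d ≤ v ∧ (d = 0 → v = 0)) ∧
        (0 < d →
          1 - 1 / (n : ℝ) - 1 / (d : ℝ) ≤
            coinLaw.real {ω | ∃ v t : ℕ, Outputs O α p σ ω v t ∧
              (v : ℝ) ≤ C * (β n * (1 + Real.log z) * √(Real.log d)) * d}) := by
  refine ⟨dyckProg, 1000, by norm_num, ?_⟩
  rintro s hs α β O hα hβ hO σ n d z rfl rfl rfl
  have key := fun ω => exists_outputs_dyckProg (by omega) hα hβ hO σ ω
  constructor
  · intro ω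
    obtain ⟨v, t, h1, h2, h3, h4, -⟩ := key ω
    exact ⟨v, t, h1, h2, h3, h4⟩
  · intro hd
    rcases Nat.lt_or_ge (dyckDist σ) 2 with h | h
    -- For d = 1 the required probability is -1/n, at most zero.
    · have h1 : dyckDist σ = 1 := by omega
      refine le_trans ?_ measureReal_nonneg
      rw [h1]
      have : (0 : ℝ) ≤ 1 / (σ.length : ℝ) := by positivity
      norm_num at this ⊢
    -- For d ≥ 2 the bound holds for every coin sequence, so the event has probability 1.
    · have huniv : {ω | ∃ v t : ℕ, Outputs O α dyckProg σ ω v t ∧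
          (v : ℝ) ≤ 1000 * (β σ.length * (1 + Real.log (numBlocks (cancel σ))) *
            √(Real.log (dyckDist σ))) * dyckDist σ} = Set.univ := by
        refine Set.eq_univ_of_forall fun ω => ?_
        obtain ⟨v, t, h1, -, -, -, h5⟩ := key ω
        exact ⟨v, t, h1, h5 h⟩
      have hprob : IsProbabilityMeasure coinLaw := by
        unfold coinLaw
        infer_instance
      rw [huniv, probReal_univ]
      have h1 : (0 : ℝ) ≤ 1 / (σ.length : ℝ) := by positivity
      have h2 : (0 : ℝ) ≤ 1 / (dyckDist σ : ℝ) := by positivity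
      linarith
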